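/- Let $K$ be a field of characteristic zero, $d\ge 0$, and let $\mathcal I$ (kernels, with regularities $\beta_i\in\mathbb R$) and $\Xi$ (noises, with regularities $\alpha_\xi\in\mathbb R$) be index sets. **Trees.** Let $\mathfrak T$ be the $K$-vector space with basis the planar rooted trees with vertices decorated by $\mathbb N^d$ and edges decorated by $(\mathcal I\cup\Xi)\times\mathbb N^d$, such that each vertex has at most one outgoing noise edge (an edge with decoration in $\Xi\times\mathbb N^d$) and each noise vertex (a vertex with an incoming noise edge) is a leaf. Write $X^n\omega$ for the tree with root decoration $n$ and ordered list of outgoing planted branches $\omega$. The regularity $|\tau|$ is the sum of $|n|$ over all vertex decorations $n$, of $\beta_i-|a|$ over kernel edges $(i,a)$ and of $\alpha_\xi-1-|a|$ over noise edges $(\xi,a)$. Let $\mathfrak T^-$ be the span of the trees with $|\tau|<0$ and $S(\mathfrak T^-)$ its symmetric algebra. **The action $\ast_+$.** For trees $X^m\omega$, without noise edge at the root, and $y$, let $(X^m\omega)\ast_+y\in\mathfrak T$ be the sum over all ways to graft the branches of $\omega$ onto non-noise vertices of $y$ (the root included), to the left of the existing branches and with branches at the same vertex keeping their order. Each grafting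 is deformed: for a vertex with decoration $n$ that receives branches with edge decorations $a_1,\dots,a_k$ one sums over $\ell_1,\dots,\ell_k\in\mathbb N^d$ with $\ell_j\le a_j$ and $\sum_j\ell_j\le n$, replaces $a_j$ by $a_j-\ell_j$ and $n$ by $n-\sum_j\ell_j$, with weight $\frac{n!}{\ell_1!\cdots\ell_k!\,(n-\sum_j\ell_j)!}$. Afterwards $m$ is distributed in all ways over the decorations of the non-noise vertices of $y$, with multinomial weight. **Deformed insertion.** For $\tau\in\mathfrak T^-$ and a tree $t$ let $\tau\mathbin{\hat\diamond}t$ be the sum over the vertices $v$ of $t$ not adjacent to a noise edge of the trees obtained by replacing the subtree $P_v$ of $t$ above $v$ (with root $v$) by $P_v\ast_+\tau$; let $\hat\diamond_{\rm nr}$ be the same sum over the vertices $v$ different from the root. Both extend to products of elements of $\mathfrak T^-$ by the Guin--Oudom rule $(\tau\omega)\mathbin{\hat\diamond}t=\tau\mathbin{\hat\diamond}(\omega\mathbin{\hat\diamond}t)-(\tau\mathbin{\hat\diamond}\omega)\mathbin{\hat\diamond}t$, respectively $(\tau\omega)\mathbin{\hat\diamond}_{\rm nr}t=\tau\mathbin{\hat\diamond}_{\rm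 nr}(\omega\mathbin{\hat\diamond}_{\rm nr}t)-(\tau\mathbin{\hat\diamond}\omega)\mathbin{\hat\diamond}_{\rm nr}t$, where $\tau\mathbin{\hat\diamond}(\cdot)$ acts on products of trees as a derivation. **Coactions.** With respect to the bilinear pairings for which the basis of trees is orthonormal, extended to $S(\mathfrak T^-)$ by $\langle\sigma_1\cdots\sigma_n,\tau_1\cdots\tau_n\rangle=\sum_\pi\prod_i\langle\sigma_i,\tau_{\pi(i)}\rangle$ (sum over permutations; products of different lengths are orthogonal), let $\Delta^+_0:\mathfrak T\to\mathfrak T\,\overline\otimes\,\mathfrak T$ be the dual of $\ast_+$ (the left tensor factors have no noise edge at the root, no condition on their regularity), and let $\Delta^-$ and $\Delta^-_{\text{non-root}}$ be the duals of the actions $\hat\diamond$ and $\hat\diamond_{\rm nr}$ of $S(\mathfrak T^-)$ on $\mathfrak T$. Here $\overline\otimes$ is the completed tensor product, i.e. formal infinite linear combinations of tensors of basis elements. Put $m^{1,3}(a\otimes b\otimes c\otimes e)=ac\otimes b\otimes e$. **Statement.** The two actions of products of trees in $\mathfrak T^-$ do not depend on the order of the factors; $\Delta^-$ and $\Delta^-_{\text{non-root}}$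 are well-defined maps $\mathfrak T\to S(\mathfrak T^-)\otimes\mathfrak T$ (with values in the algebraic tensor product); the maps ${\rm Id}\otimes\Delta^+_0$ and $\Delta^-_{\text{non-root}}\otimes\Delta^-$ extend to formal infinite linear combinations, each coefficient of the result being a finite sum; and $$({\rm Id}\otimes\Delta^+_0)\,\Delta^- \;=\; m^{1,3}\,(\Delta^-_{\text{non-root}}\otimes\Delta^-)\,\Delta^+_0\qquad\text{on }\mathfrak T .$$ -/

import Mathlib

noncomputable section

namespace PlanarRS

/-- Planted forests: ordered lists (from left to right) of planted branches.  A branch is either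

* a noise edge with decoration `(ξ, a)` leading to a noise vertex with decoration `k` (a noise vertex
  has no outgoing edges), or
* a kernel edge with decoration `(i, a)` leading to a vertex with decoration `n`, whose own outgoing
  branches form the planted forest `sub`.

`d` is the number of components of the decorations, `κ` indexes the kernels, `ι` the noises. -/
inductive Forest (d : ℕ) (κ ι : Type*)
  | nil : Forest d κ ι
  | noise (ξ : ι) (a k : Fin d → ℕ) (rest : Forest d κ ι) : Forest d κ ι
  | kernel (i : κ) (a n : Fin d → ℕ) (sub rest : Forest d κ ι) : Forest d κ ι

/-- The planar decorated tree `X^n ω`: the root has decoration `n` and outgoing branches `ω`. -/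
abbrev PTree (d : ℕ) (κ ι : Type*) := (Fin d → ℕ) × Forest d κ ι

namespace Forest

variable {d : ℕ} {κ ι : Type*}

/-- Concatenation, i.e. merging two planted forests at their roots. -/
def append : Forest d κ ι → Forest d κ ι → Forest d κ ι
  | nil, η => η
  | noise ξ a k r, η => noise ξ a k (append r η)
  | kernel i a n s r, η => kernel i a n s (append r η)

/-- The number of noise edges that are outgoing from the root. -/
def rootNoise : Forest d κ ι → ℕ
  | nil => 0
  | noise _ _ _ r => rootNoise r + 1
  | kernel _ _ _ _ r => rootNoise r

/-- Every vertex has at most one outgoing noise edge. -/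
def Valid : Forest d κ ι → Prop
  | nil => True
  | noise _ _ _ r => rootNoise r = 0 ∧ Valid r
  | kernel _ _ _ s r => Valid s ∧ Valid r

/-- The deshuffle coproduct: all ways to split the branches into two ordered sublists. -/
def deshuffle : Forest d κ ι → List (Forest d κ ι × Forest d κ ι)
  | nil => [(nil, nil)]
  | noise ξ a k r =>
      (deshuffle r).map (fun p => (noise ξ a k p.1, p.2)) ++
      (deshuffle r).map (fun p => (p.1, noise ξ a k p.2))
  | kernel i a n s r =>
      (deshuffle r).map (fun p => (kernel i a n s p.1, p.2)) ++
      (deshuffle r).map (fun p => (p.1, kernel i a n s p.2))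

/-- Regularity of a planted forest: a kernel edge `(i, a)` contributes `β i - |a|`, a noise edge
`(ξ, a)` contributes `α ξ - 1 - |a|`, a vertex with decoration `n` contributes `|n|`. -/
def reg (β : κ → ℝ) (α : ι → ℝ) : Forest d κ ι → ℝ
  | nil => 0
  | noise ξ a k r => (α ξ - 1 - ∑ j, (a j : ℝ)) + (∑ j, (k j : ℝ)) + reg β α r
  | kernel i a n s r =>
      (β i - ∑ j, (a j : ℝ)) + (∑ j, (n j : ℝ)) + reg β α s + reg β α r

end Forest

open Forest

section Trees

variable {d : ℕ} {κ ι : Type*}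

/-- Regularity of the tree `X^n ω`. -/
def reg (β : κ → ℝ) (α : ι → ℝ) (t : PTree d κ ι) : ℝ := (∑ j, (t.1 j : ℝ)) + t.2.reg β α

variable (d κ ι) in
/-- The basis of the model space: trees in which every vertex has at most one outgoing noise edge
(and noise vertices have no outgoing edge). -/
abbrev Tree := {t : PTree d κ ι // t.2.Valid}

variable (d) in
/-- The basis of the space of trees of negative regularity. -/
abbrev NegTree {κ ι : Type*} (β : κ → ℝ) (α : ι → ℝ) :=
  {t : PTree d κ ι // t.2.Valid ∧ reg β α t < 0}

variable (d) in
/-- The monomial basis of the symmetric algebra over the space of trees of negative regularity. -/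
abbrev NegMon {κ ι : Type*} (β : κ → ℝ) (α : ι → ℝ) := NegTree d β α →₀ ℕ

/-- Multi-index binomial coefficient. -/
def mchoose (m l : Fin d → ℕ) : ℕ := ∏ j, (m j).choose (l j)

end Trees

section Products

variable (K : Type*) [Field K] {d : ℕ} {κ ι : Type*}

/-- Deformed grafting of all branches of a planted forest onto one vertex with decoration `n`:
every branch, with edge decoration `a`, is individually deformed by an `ℓ ≤ a` that is subtracted
from `a` and from the vertex decoration, weighted by a binomial coefficient.  The result consists of
the new vertex decoration and the deformed branches.  Noise edges cannot be grafted. -/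
def attach : Forest d κ ι → (Fin d → ℕ) → (PTree d κ ι →₀ K)
  | nil, n => Finsupp.single (n, nil) 1
  | noise _ _ _ _, _ => 0
  | kernel i a m s r, n =>
      ∑ l ∈ Finset.Icc 0 (n ⊓ a), (attach r (n - l)).sum fun p c =>
        Finsupp.single (p.1, kernel i (a - l) m s p.2) ((mchoose n l : K) * c)

/-- Deformed grafting of `X^m ω` onto the vertex with decoration `n` at the root of a tree and onto
the remaining tree, where `F` is the deformed grafting onto the non-root vertices.  The splitting of
`X^m ω` is its deshuffle coproduct, and `X^{m₁}` raises the decoration of the vertex. -/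
def graftRoot (F : (Fin d → ℕ) → Forest d κ ι → (Forest d κ ι →₀ K))
    (m : Fin d → ℕ) (ω : Forest d κ ι) (n : Fin d → ℕ) : PTree d κ ι →₀ K :=
  ∑ m₁ ∈ Finset.Icc 0 m, ((deshuffle ω).map fun p =>
    (attach K p.1 n).sum fun q c => (F (m - m₁) p.2).sum fun u e =>
      Finsupp.single (q.1 + m₁, q.2.append u) ((mchoose m m₁ : K) * c * e)).sum

/-- `graftForest K η m ω` is the deformed grafting of `X^m ω` onto the planted forest `η`, i.e. onto
all its non-root non-noise vertices: `X^m ω` is split over the branches of `η` by the deshuffle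
coproduct, nothing is grafted onto a noise vertex. -/
def graftForest : Forest d κ ι → (Fin d → ℕ) → Forest d κ ι → (Forest d κ ι →₀ K)
  | nil, m, nil => if m = 0 then Finsupp.single nil 1 else 0
  | nil, _, _ => 0
  | noise ξ a k r, m, ω => (graftForest r m ω).sum fun u c => Finsupp.single (noise ξ a k u) c
  | kernel i a n s r, m, ω =>
      ∑ m₁ ∈ Finset.Icc 0 m, ((deshuffle ω).map fun p =>
        (graftRoot K (graftForest s) m₁ p.1 n).sum fun t c =>
          (graftForest r (m - m₁) p.2).sum fun u e =>
            Finsupp.single (kernel i a t.1 t.2 u) ((mchoose m m₁ : K) * c * e)).sum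

/-- The deformed Grossman--Larson action `(X^m ω) ∗₊ (X^n η)`. -/
def glAct (x y : PTree d κ ι) : PTree d κ ι →₀ K :=
  graftRoot K (graftForest K y.2) x.1 x.2 y.1

/-- Deformed insertion of `τ` into the tree `X^n s`, given the sum `F` of the insertions into its
non-root vertices.  Inserting `τ` into a vertex not adjacent to a noise edge identifies the root of
`τ` with the vertex; the outgoing edges of the vertex are deformed-grafted onto `τ` and its
decoration is distributed over `τ`, so that the result is `(X^n s) ∗₊ τ`. -/
def insertRoot (τ : PTree d κ ι) (F : Forest d κ ι →₀ K) (n : Fin d → ℕ) (s : Forest d κ ι) :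
    PTree d κ ι →₀ K :=
  (if s.rootNoise = 0 then glAct K (n, s) τ else 0) + F.sum fun u c => Finsupp.single (n, u) c

/-- Sum of the deformed insertions of `τ` into the non-root vertices of a planted forest. -/
def insertForest (τ : PTree d κ ι) : Forest d κ ι → (Forest d κ ι →₀ K)
  | nil => 0
  | noise ξ a k r => (insertForest τ r).sum fun u c => Finsupp.single (noise ξ a k u) c
  | kernel i a n s r =>
      ((insertRoot K τ (insertForest τ s) n s).sum fun t c =>
        Finsupp.single (kernel i a t.1 t.2 r) c) +
      (insertForest τ r).sum fun u c => Finsupp.single (kernel i a n s u) c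

/-- The deformed insertion of `τ` into `t`: the sum of the insertions into all vertices of `t` that
are not adjacent to a noise edge. -/
def insertion (τ t : PTree d κ ι) : PTree d κ ι →₀ K :=
  insertRoot K τ (insertForest K τ t.2) t.1 t.2

/-- The same, without the insertion into the root of `t`. -/
def insertionNonRoot (τ t : PTree d κ ι) : PTree d κ ι →₀ K :=
  (insertForest K τ t.2).sum fun u c => Finsupp.single (t.1, u) c

/-- Guin--Oudom extension of an insertion `I` to products `τ₀ ⋯ τ_{n-1}` of trees:
`(τ₀ ω) ▹ t = τ₀ ▹ (ω ▹ t) - (τ₀ ▹ ω) ▹ t`, where in `τ₀ ▹ ω` the tree `τ₀` is inserted into the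
factors of `ω` as a derivation, always by the full deformed insertion. -/
def act (I : PTree d κ ι → PTree d κ ι → (PTree d κ ι →₀ K)) :
    (n : ℕ) → (Fin n → PTree d κ ι) → PTree d κ ι → (PTree d κ ι →₀ K)
  | 0, _, t => Finsupp.single t 1
  | n + 1, τ, t =>
      ((act I n (Fin.tail τ) t).sum fun u c => c • I (τ 0) u) -
      ∑ j : Fin n, (insertion K (τ 0) (Fin.tail τ j)).sum fun σ c =>
        c • act I n (Function.update (Fin.tail τ) j σ) t

/-- The action of a monomial of trees of negative regularity; the factors are taken in some order. -/
def actMon {β : κ → ℝ} {α : ι → ℝ} (I : PTree d κ ι → PTree d κ ι → (PTree d κ ι →₀ K))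
    (a : NegMon d β α) (t : PTree d κ ι) : PTree d κ ι →₀ K :=
  act K I (Finsupp.toMultiset a).toList.length (fun i => ((Finsupp.toMultiset a).toList.get i).1) t

end Products

section Coactions

variable (K : Type*) [Field K] {d : ℕ} {κ ι : Type*}

/-- Formal (possibly infinite) linear combinations of the elements of the basis `A`.  Completed
tensor products are the spaces `Ser K (A × B)`. -/
abbrev Ser (A : Type*) := A → K

/-- The recentering coaction without projection onto positive trees: the dual of `∗₊`, whose left
argument has no noise edge at the root, with respect to the bases of trees. -/
def deltaPlusZero (z : Tree d κ ι) : Ser K (Tree d κ ι × Tree d κ ι) := fun p =>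
  if p.1.1.2.rootNoise = 0 then glAct K p.1.1 p.2.1 z.1 else 0

/-- The dual of the action of the symmetric algebra that is generated by the insertion `I`.  The
symmetric algebra is paired with itself by
`⟨σ₁ ⋯ σ_n, τ₁ ⋯ τ_n⟩ = ∑_π ∏ i, ⟨σ_i, τ_{π i}⟩`, so a monomial `∏ τ ^ a τ` has square norm
`∏ (a τ)!`. -/
def dualCoaction (β : κ → ℝ) (α : ι → ℝ) (I : PTree d κ ι → PTree d κ ι → (PTree d κ ι →₀ K))
    (z : Tree d κ ι) : Ser K (NegMon d β α × Tree d κ ι) := fun p =>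
  (p.1.prod fun _ k => (k.factorial : K))⁻¹ * actMon K I p.1 p.2.1 z.1

/-- The deformed coaction for negative renormalisation. -/
def deltaMinus (β : κ → ℝ) (α : ι → ℝ) :
    Tree d κ ι → Ser K (NegMon d β α × Tree d κ ι) :=
  dualCoaction K β α (insertion K)

/-- The variant that does not contract subtrees containing the root. -/
def deltaMinusNonRoot (β : κ → ℝ) (α : ι → ℝ) :
    Tree d κ ι → Ser K (NegMon d β α × Tree d κ ι) :=
  dualCoaction K β α (insertionNonRoot K)

open Classical in
/-- The identity, as a map from a basis to formal linear combinations. -/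
def idMap (A : Type*) : A → Ser K A := fun a b => if a = b then 1 else 0

/-- Linear extension of a map defined on a basis. -/
def lin {A B : Type*} (f : A → Ser K B) : (A →₀ K) →ₗ[K] Ser K B := Finsupp.linearCombination K f

/-- The tensor product `f ⊗ g` extends to formal linear combinations: every coefficient of the
result only depends on finitely many coefficients of the argument. -/
def Extends {A B C D : Type*} (f : A → Ser K B) (g : C → Ser K D) : Prop :=
  ∀ b e, {p : A × C | f p.1 b * g p.2 e ≠ 0}.Finite

/-- The tensor product `f ⊗ g` on formal linear combinations. -/
def tensorMap {A B C D : Type*} (f : A → Ser K B) (g : C → Ser K D) (F : Ser K (A × C)) :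
    Ser K (B × D) := fun q => ∑ᶠ p : A × C, F p * (f p.1 q.1 * g p.2 q.2)

open Classical in
/-- The map `a ⊗ b ⊗ c ⊗ e ↦ a c ⊗ b ⊗ e`, where `a`, `c` are multiplied as commutative monomials
with exponents in `M →₀ ℕ`. -/
def mul13 {M B D : Type*} (F : Ser K (((M →₀ ℕ) × B) × ((M →₀ ℕ) × D))) :
    Ser K ((M →₀ ℕ) × (B × D)) := fun q =>
  ∑ p ∈ Finset.HasAntidiagonal.antidiagonal q.1, F ((p.1, q.2.1), (p.2, q.2.2))

end Coactions

end PlanarRS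

end

/-! The three coactions are transposes of actions, so the identity reduces to one about actions
(`bind_glAct_multi`): inserting a monomial m into x ∗₊ y gives the sum, over all splittings m =
m₁m₂, of (m₁ inserted into x off the root) ∗₊ (m₂ inserted into y). The root of x disappears in x ∗₊
y, hence the non-root variant in the left factor.

For a single τ this is a Leibniz rule, `bind_glAct_insertion`. The vertices of x ∗₊ y come from the
non-root vertices of x and from the vertices of y. Above a vertex v of y now stands x' ∗₊ P_v, where
x' is the part of x that this subtree received, and (x' ∗₊ P_v) ∗₊ τ = x' ∗₊ (P_v ∗₊ τ). So the core
is the associativity of ∗₊ (`bind_glAct_glAct`). It follows by structural induction from two facts: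
∗₊ respects the coproduct that distributes a tree over several places (`bind_glAct_cop`), and
successive deformations at one vertex compose (`bind_attach_attach`, a form of the Vandermonde
identity).

For products, the Guin–Oudom recursion has the closed solution `multi`, simultaneous insertion into
pairwise distinct vertices. It sees only the multiset of factors, which is the independence of their
order, and the recursion `bind_multi_insertion` carries the Leibniz rule from one tree to monomials.

Finiteness is bookkeeping: the actions add up edge labels, preserve total vertex decoration minus
total edge decoration, and satisfy suitable lower bounds. Negative regularity bounds the vertex
decorations of a factor and forces it to have an edge. In the dualisation, the square norms a! of
monomials match the multiplicities of the splittings (`bind₂_monSplit_toMultiset`). -/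

noncomputable section

namespace PlanarRS

open Forest

/-! ### Calculus of linear extensions -/

section Bind

variable {K : Type*} [Field K] {A B C W V : Type*}
  [AddCommGroup W] [Module K W] [AddCommGroup V] [Module K V]

/-- Linear extension of `h`, evaluated at the formal linear combination `e`. -/
def bind (e : A →₀ K) (h : A → W) : W := Finsupp.linearCombination K h e

theorem bind_eq_sum (e : A →₀ K) (h : A → W) : bind e h = e.sum fun a c => c • h a := rfl

@[simp] theorem bind_single (a : A) (c : K) (h : A → W) :
    bind (Finsupp.single a c) h = c • h a := by simp [bind]

theorem bind_pure (a : A) (h : A → W) :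
    bind (Finsupp.single a (1 : K)) h = h a := by simp [bind]

@[simp] theorem bind_zero (h : A → W) : bind (0 : A →₀ K) h = 0 := by simp [bind]

theorem bind_add (e f : A →₀ K) (h : A → W) : bind (e + f) h = bind e h + bind f h := by
  simp [bind]

theorem bind_sum {ι : Type*} (s : Finset ι) (e : ι → A →₀ K) (h : A → W) :
    bind (∑ i ∈ s, e i) h = ∑ i ∈ s, bind (e i) h := by
  simp [bind]

theorem map_bind (φ : W →ₗ[K] V) (e : A →₀ K) (h : A → W) :
    φ (bind e h) = bind e fun a => φ (h a) := by
  simp only [bind_eq_sum, Finsupp.sum, map_sum, map_smul]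

theorem bind_bind (e : A →₀ K) (f : A → B →₀ K) (h : B → W) :
    bind (bind e f) h = bind e fun a => bind (f a) h :=
  map_bind (Finsupp.linearCombination K h) e f

theorem bind_single_one (e : A →₀ K) : bind e (fun a => Finsupp.single a (1 : K)) = e := by
  simp [bind_eq_sum]

theorem bind_comm (e : A →₀ K) (f : B →₀ K) (h : A → B → W) :
    (bind e fun a => bind f fun b => h a b) = bind f fun b => bind e fun a => h a b := by
  simp only [bind_eq_sum, Finsupp.sum, Finset.smul_sum]
  rw [Finset.sum_comm]
  exact Finset.sum_congr rfl fun b _ => Finset.sum_congr rfl fun a _ => smul_comm _ _ _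

@[simp] theorem bind_fun_zero (e : A →₀ K) : bind e (fun _ => (0 : W)) = 0 := by
  simp [bind_eq_sum]

theorem bind_fun_add (e : A →₀ K) (f h : A → W) :
    (bind e fun a => f a + h a) = bind e f + bind e h := by
  simp [bind_eq_sum, Finsupp.sum, Finset.sum_add_distrib]

theorem bind_fun_sub (e : A →₀ K) (f h : A → W) :
    (bind e fun a => f a - h a) = bind e f - bind e h := by
  simp [bind_eq_sum, Finsupp.sum, Finset.sum_sub_distrib, smul_sub]

theorem bind_fun_smul (e : A →₀ K) (c : K) (f : A → W) :
    (bind e fun a => c • f a) = c • bind e f := by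
  simp [bind_eq_sum, Finsupp.sum, Finset.smul_sum, smul_comm c]

theorem sum_single_eq_bind (e : A →₀ K) (g : A → B) :
    (e.sum fun a c => Finsupp.single (g a) c) = bind e fun a => Finsupp.single (g a) 1 := by
  simp [bind_eq_sum]

theorem bind_apply (e : A →₀ K) (h : A → B →₀ K) (b : B) :
    bind e h b = e.sum fun a c => c * h a b := by
  simp [bind_eq_sum, Finsupp.sum]

theorem bind_list_sum (l : List (A →₀ K)) (h : A → W) :
    bind l.sum h = (l.map fun e => bind e h).sum := by
  induction l with
  | nil => simp
  | cons a l ih => simp [bind_add, ih]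

theorem bind_ite_zero (p : Prop) [Decidable p] (e : A →₀ K) (h : A → W) :
    bind (if p then e else 0) h = if p then bind e h else 0 := by
  split_ifs <;> simp

/-- Linear extension of a function of two variables. -/
def bind₂ (e : (A × B) →₀ K) (h : A → B → W) : W := bind e fun p => h p.1 p.2

theorem bind₂_eq (e : (A × B) →₀ K) (h : A → B → W) :
    bind₂ e h = bind e fun p => h p.1 p.2 := rfl

theorem bind₂_pure (a : A) (b : B) (h : A → B → W) :
    bind₂ (Finsupp.single (a, b) (1 : K)) h = h a b := bind_pure _ _

theorem bind₂_bind₂_pair {D : Type*} (e : (C × D) →₀ K) (f : C → D → (A × B) →₀ K)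
    (h : A → B → W) :
    bind₂ (bind₂ e f) h = bind₂ e fun c d => bind₂ (f c d) h := bind_bind _ _ _

theorem bind_bind₂ (e : (A × B) →₀ K) (f : A → B → C →₀ K) (h : C → W) :
    bind (bind₂ e f) h = bind₂ e fun a b => bind (f a b) h := bind_bind _ _ _

theorem bind_bind₂_comm (e : A →₀ K) (f : (B × C) →₀ K) (h : A → B → C → W) :
    (bind e fun a => bind₂ f fun b c => h a b c) =
      bind₂ f fun b c => bind e fun a => h a b c := bind_comm _ _ _

theorem bind₂_comm {D : Type*} (e : (A × D) →₀ K) (f : (B × C) →₀ K) (h : A → D → B → C → W) :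
    (bind₂ e fun a d => bind₂ f fun b c => h a d b c) =
      bind₂ f fun b c => bind₂ e fun a d => h a d b c := bind_comm _ _ _

@[simp] theorem bind₂_fun_zero (e : (A × B) →₀ K) : bind₂ e (fun _ _ => (0 : W)) = 0 :=
  bind_fun_zero e

theorem bind₂_fun_add (e : (A × B) →₀ K) (f h : A → B → W) :
    (bind₂ e fun a b => f a b + h a b) = bind₂ e f + bind₂ e h := bind_fun_add _ _ _

end Bind

-- Kept opaque, so that formal sums are manipulated only as binders, through linearity and
-- interchange of summations.
attribute [irreducible] bind bind₂

/-! ### The binomial coproduct of polynomials -/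

section Splitting

variable (K : Type*) [Field K] {d : ℕ} {κ ι : Type*} {W : Type*} [AddCommGroup W] [Module K W]

/-- The binomial coproduct of `X^m`. -/
def msplit (m : Fin d → ℕ) : ((Fin d → ℕ) × (Fin d → ℕ)) →₀ K :=
  ∑ l ∈ Finset.Icc 0 m, Finsupp.single (l, m - l) (mchoose m l : K)

variable {K}

theorem bind₂_msplit (m : Fin d → ℕ) (h : (Fin d → ℕ) → (Fin d → ℕ) → W) :
    bind₂ (msplit K m) h = ∑ l ∈ Finset.Icc 0 m, (mchoose m l : K) • h l (m - l) := by
  simp [msplit, bind₂_eq, bind_sum]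

theorem bind₂_msplit_zero (h : (Fin d → ℕ) → (Fin d → ℕ) → W) :
    bind₂ (msplit K 0) h = h 0 0 := by
  simp [bind₂_msplit, mchoose]

theorem mchoose_eq_zero {m l : Fin d → ℕ} (h : ¬ l ≤ m) : mchoose m l = 0 := by
  simp only [Pi.le_def, not_forall, not_le] at h
  obtain ⟨i, hi⟩ := h
  exact Finset.prod_eq_zero (Finset.mem_univ i) (Nat.choose_eq_zero_of_lt hi)

/-- Pascal's rule in the i-th coordinate; the other factors of the product agree. The guard excludes
truncated subtraction. -/
theorem mchoose_succ (m l : Fin d → ℕ) (i : Fin d) :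
    mchoose (m + Pi.single i 1) l =
      mchoose m l + if 1 ≤ l i then mchoose m (l - Pi.single i 1) else 0 := by
  have key : ∀ f : Fin d → ℕ, ∏ j, f j = f i * ∏ j ∈ Finset.univ.erase i, f j := fun f =>
    (Finset.mul_prod_erase _ _ (Finset.mem_univ i)).symm
  have h1 : ∀ j ∈ Finset.univ.erase i, ((m + Pi.single i 1 : Fin d → ℕ) j).choose (l j) =
      (m j).choose (l j) := fun j hj => by simp [Finset.ne_of_mem_erase hj]
  have h2 : ∀ j ∈ Finset.univ.erase i, (m j).choose ((l - Pi.single i 1 : Fin d → ℕ) j) =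
      (m j).choose (l j) := fun j hj => by simp [Finset.ne_of_mem_erase hj]
  unfold mchoose
  rw [key, key fun j => (m j).choose (l j),
    show ∏ j, (m j).choose ((l - Pi.single i 1 : Fin d → ℕ) j) = _ from key _,
    Finset.prod_congr rfl h1, Finset.prod_congr rfl h2]
  rcases hl : l i with _ | k
  · simp
  · simp [hl, Nat.choose_succ_succ]; ring

/-- Pascal's rule says that X_i is primitive for a multiplicative coproduct. Together with induction
on |m| this yields cocommutativity, coassociativity and multiplicativity without computing with
binomials. -/
theorem bind₂_msplit_succ (m : Fin d → ℕ) (i : Fin d) (h : (Fin d → ℕ) → (Fin d → ℕ) → W) :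
    bind₂ (msplit K (m + Pi.single i 1)) h =
      bind₂ (msplit K m) fun a b => h (a + Pi.single i 1) b + h a (b + Pi.single i 1) := by
  simp only [bind₂_msplit, mchoose_succ, Nat.cast_add, add_smul, Finset.sum_add_distrib, smul_add]
  rw [add_comm]
  congr 1
  -- The shifted half of Pascal's rule: reindexing by adding the i-th unit vector.
  · simp only [Nat.cast_ite, Nat.cast_zero, ite_smul, zero_smul]
    rw [← Finset.sum_filter]
    symm
    refine Finset.sum_bij' (fun l _ => l + Pi.single i 1) (fun l _ => l - Pi.single i 1)
      ?_ ?_ ?_ ?_ ?_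
    · intro l hl
      simp only [Finset.mem_Icc, zero_le, true_and, Finset.mem_filter] at hl ⊢
      exact ⟨add_le_add_left hl _, by simp⟩
    · intro l hl
      simp only [Finset.mem_Icc, zero_le, true_and, Finset.mem_filter] at hl ⊢
      exact tsub_le_iff_right.2 hl.1
    · intro l _; simp
    · intro l hl
      simp only [Finset.mem_Icc, zero_le, true_and, Finset.mem_filter] at hl
      refine tsub_add_cancel_of_le fun j => ?_
      by_cases hj : j = i
      · subst hj; simpa using hl.2
      · simp [hj]
    · intro l hl
      simp [add_tsub_add_eq_tsub_right]
  -- The unshifted half: the additional indices have l ≰ m and hence a vanishing binomial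
  -- coefficient.
  · symm
    refine Finset.sum_subset_zero_on_sdiff
      (Finset.Icc_subset_Icc le_rfl (le_add_of_nonneg_right zero_le)) ?_ ?_
    · intro l hl
      simp only [Finset.mem_sdiff, Finset.mem_Icc, zero_le, true_and] at hl
      simp [mchoose_eq_zero hl.2]
    · intro l hl
      rw [tsub_add_eq_add_tsub (Finset.mem_Icc.1 hl).2]

theorem multiindex_induction {P : (Fin d → ℕ) → Prop} (h0 : P 0)
    (hs : ∀ m i, P m → P (m + Pi.single i 1)) (m : Fin d → ℕ) : P m := by
  have H : ∀ n (m : Fin d → ℕ), ∑ i, m i = n → P m := by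
    intro n
    induction n with
    | zero =>
      intro m hm
      have : m = 0 := by
        ext i
        exact (Finset.sum_eq_zero_iff.1 hm) i (Finset.mem_univ i)
      exact this ▸ h0
    | succ n ih =>
      intro m hm
      obtain ⟨i, hi⟩ : ∃ i, m i ≠ 0 := by
        by_contra! h
        simp [h] at hm
      have e : m - Pi.single i 1 + Pi.single i 1 = m := by
        refine tsub_add_cancel_of_le fun j => ?_
        by_cases hj : j = i
        · subst hj; simpa using Nat.one_le_iff_ne_zero.2 hi
        · simp [hj]
      rw [← e]
      refine hs _ _ (ih _ ?_)
      have : ∑ j, (m - Pi.single i 1 + Pi.single i 1 : Fin d → ℕ) j = n + 1 := by rw [e, hm]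
      simp only [Pi.add_apply, Finset.sum_add_distrib, Finset.sum_pi_single', Finset.mem_univ,
        if_true] at this
      simpa using this
  exact H _ m rfl

theorem bind₂_msplit_comm (m : Fin d → ℕ) (h : (Fin d → ℕ) → (Fin d → ℕ) → W) :
    bind₂ (msplit K m) h = bind₂ (msplit K m) fun a b => h b a := by
  induction m using multiindex_induction generalizing h with
  | h0 => simp [bind₂_msplit_zero]
  | hs m i ih =>
    rw [bind₂_msplit_succ, bind₂_msplit_succ]
    refine (ih _).trans ?_
    simp only [add_comm]

theorem bind₂_msplit_coassoc (m : Fin d → ℕ)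
    (h : (Fin d → ℕ) → (Fin d → ℕ) → (Fin d → ℕ) → W) :
    (bind₂ (msplit K m) fun p c => bind₂ (msplit K p) fun a b => h a b c) =
      bind₂ (msplit K m) fun a q => bind₂ (msplit K q) fun b c => h a b c := by
  induction m using multiindex_induction generalizing h with
  | h0 => simp [bind₂_msplit_zero]
  | hs m i ih =>
    simp only [bind₂_msplit_succ, bind₂_fun_add]
    rw [ih, ih, ih]
    abel

/-- Vandermonde's identity. It is needed wherever a vertex decoration is a sum, one part belonging
to the vertex and one to the grafted polynomial. -/
theorem bind₂_msplit_add (m n : Fin d → ℕ) (h : (Fin d → ℕ) → (Fin d → ℕ) → W) :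
    bind₂ (msplit K (m + n)) h =
      bind₂ (msplit K m) fun a b => bind₂ (msplit K n) fun a' b' => h (a + a') (b + b') := by
  induction m using multiindex_induction generalizing h with
  | h0 => simp [bind₂_msplit_zero]
  | hs m i ih =>
    rw [add_right_comm, bind₂_msplit_succ, bind₂_msplit_succ]
    refine (ih _).trans ?_
    simp only [bind₂_fun_add, add_right_comm]

theorem bind₂_msplit_counit (m : Fin d → ℕ) (h : (Fin d → ℕ) → W) :
    (bind₂ (msplit K m) fun a b => if a = 0 then h b else 0) = h m := by
  simp only [bind₂_msplit, smul_ite, smul_zero]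
  rw [Finset.sum_ite_eq' _ 0]
  simp [mchoose]

open Classical in
variable (K) in
/-- The lowered edge decoration `a - l`, or zero if this is not a multi-index. -/
def lower (a l : Fin d → ℕ) : (Fin d → ℕ) →₀ K := if l ≤ a then Finsupp.single (a - l) 1 else 0

@[simp] theorem bind_lower_zero (a : Fin d → ℕ) (h : (Fin d → ℕ) → W) :
    bind (lower K a 0) h = h a := by simp [lower]

/-- An edge may be deformed twice in succession: l ≤ a and k ≤ a - l together amount to l + k ≤ a.
-/
theorem bind_lower_add (a l k : Fin d → ℕ) (h : (Fin d → ℕ) → W) :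
    bind (lower K a (l + k)) h = bind (lower K a l) fun b => bind (lower K b k) h := by
  simp only [lower, bind_ite_zero, bind_pure]
  by_cases hl : l ≤ a
  · have : l + k ≤ a ↔ k ≤ a - l := by
      rw [le_tsub_iff_left hl]
    by_cases hk : k ≤ a - l
    · simp only [hl, hk, this.2 hk, tsub_add_eq_tsub_tsub, if_true]
    · simp only [hl, hk, mt this.1 hk, if_true, if_false]
  · have : ¬ l + k ≤ a := fun H => hl ((le_add_of_nonneg_right zero_le).trans H)
    simp [hl, this]

end Splitting

attribute [irreducible] msplit lower

/-! ### The coproduct of trees -/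

section Coproduct

variable (K : Type*) [Field K] {d : ℕ} {κ ι : Type*} {W : Type*} [AddCommGroup W] [Module K W]

/-- The deshuffle coproduct as a formal linear combination. -/
def dsh (ω : Forest d κ ι) : (Forest d κ ι × Forest d κ ι) →₀ K :=
  ((deshuffle ω).map fun p => Finsupp.single p (1 : K)).sum

/-- The coproduct of `X^m ω`. -/
def cop (x : PTree d κ ι) : (PTree d κ ι × PTree d κ ι) →₀ K :=
  bind₂ (msplit K x.1) fun a b => bind₂ (dsh K x.2) fun u v => Finsupp.single ((a, u), (b, v)) 1

variable {K}

theorem bind₂_dsh (ω : Forest d κ ι) (h : Forest d κ ι → Forest d κ ι → W) :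
    bind₂ (dsh K ω) h = ((deshuffle ω).map fun p => h p.1 p.2).sum := by
  simp [dsh, bind₂_eq, bind_list_sum, Function.comp_def]

@[simp] theorem bind₂_dsh_nil (h : Forest d κ ι → Forest d κ ι → W) :
    bind₂ (dsh K nil) h = h nil nil := by
  simp [bind₂_dsh, deshuffle]

theorem bind₂_dsh_noise (ξ : ι) (a k : Fin d → ℕ) (r : Forest d κ ι)
    (h : Forest d κ ι → Forest d κ ι → W) :
    bind₂ (dsh K (noise ξ a k r)) h =
      bind₂ (dsh K r) fun u v => h (noise ξ a k u) v + h u (noise ξ a k v) := by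
  rw [bind₂_fun_add]
  simp [bind₂_dsh, deshuffle, Function.comp_def]

theorem bind₂_dsh_kernel (i : κ) (a n : Fin d → ℕ) (s r : Forest d κ ι)
    (h : Forest d κ ι → Forest d κ ι → W) :
    bind₂ (dsh K (kernel i a n s r)) h =
      bind₂ (dsh K r) fun u v => h (kernel i a n s u) v + h u (kernel i a n s v) := by
  rw [bind₂_fun_add]
  simp [bind₂_dsh, deshuffle, Function.comp_def]

theorem bind₂_cop (x : PTree d κ ι) (h : PTree d κ ι → PTree d κ ι → W) :
    bind₂ (cop K x) h =
      bind₂ (msplit K x.1) fun a b => bind₂ (dsh K x.2) fun u v => h (a, u) (b, v) := by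
  simp only [cop, bind₂_bind₂_pair, bind₂_pure]

theorem bind₂_dsh_comm (ω : Forest d κ ι) (h : Forest d κ ι → Forest d κ ι → W) :
    bind₂ (dsh K ω) h = bind₂ (dsh K ω) fun u v => h v u := by
  induction ω generalizing h with
  | nil => simp
  | noise ξ a k r ih =>
    rw [bind₂_dsh_noise, bind₂_dsh_noise]
    refine (ih _).trans ?_
    simp only [add_comm]
  | kernel i a n s r _ ih =>
    rw [bind₂_dsh_kernel, bind₂_dsh_kernel]
    refine (ih _).trans ?_
    simp only [add_comm]

theorem bind₂_dsh_coassoc (ω : Forest d κ ι)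
    (h : Forest d κ ι → Forest d κ ι → Forest d κ ι → W) :
    (bind₂ (dsh K ω) fun p c => bind₂ (dsh K p) fun a b => h a b c) =
      bind₂ (dsh K ω) fun a q => bind₂ (dsh K q) fun b c => h a b c := by
  induction ω generalizing h with
  | nil => simp
  | noise ξ a k r ih =>
    simp only [bind₂_dsh_noise, bind₂_fun_add]
    rw [ih, ih, ih]
    abel
  | kernel i a n s r _ ih =>
    simp only [bind₂_dsh_kernel, bind₂_fun_add]
    rw [ih, ih, ih]
    abel

theorem bind₂_cop_comm (x : PTree d κ ι) (h : PTree d κ ι → PTree d κ ι → W) :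
    bind₂ (cop K x) h = bind₂ (cop K x) fun u v => h v u := by
  rw [bind₂_cop, bind₂_cop, bind₂_msplit_comm]
  congr 1; ext a b
  rw [bind₂_dsh_comm]

theorem bind₂_cop_coassoc (x : PTree d κ ι)
    (h : PTree d κ ι → PTree d κ ι → PTree d κ ι → W) :
    (bind₂ (cop K x) fun p c => bind₂ (cop K p) fun a b => h a b c) =
      bind₂ (cop K x) fun a q => bind₂ (cop K q) fun b c => h a b c := by
  simp only [bind₂_cop]
  simp only [bind₂_comm (dsh K _) (msplit K _)]
  rw [bind₂_msplit_coassoc]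
  congr 1; ext a b
  congr 1; ext a b
  rw [bind₂_dsh_coassoc]

theorem bind₂_dsh_append (ω η : Forest d κ ι) (h : Forest d κ ι → Forest d κ ι → W) :
    bind₂ (dsh K (ω.append η)) h =
      bind₂ (dsh K ω) fun u v => bind₂ (dsh K η) fun u' v' => h (u.append u') (v.append v') := by
  induction ω generalizing h with
  | nil => simp [append]
  | noise ξ a k r ih =>
    simp only [append, bind₂_dsh_noise, ih, bind₂_fun_add]
  | kernel i a n s r _ ih =>
    simp only [append, bind₂_dsh_kernel, ih, bind₂_fun_add]

end Coproduct

/-! ### The grafting operations in terms of the coproduct -/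

section Products

variable {K : Type*} [Field K] {d : ℕ} {κ ι : Type*} {W : Type*} [AddCommGroup W] [Module K W]

theorem append_nil (ω : Forest d κ ι) : ω.append nil = ω := by
  induction ω with
  | nil => rfl
  | noise ξ a k r ih => simp [append, ih]
  | kernel i a n s r _ ih => simp [append, ih]

theorem append_assoc (ω η ζ : Forest d κ ι) :
    (ω.append η).append ζ = ω.append (η.append ζ) := by
  induction ω with
  | nil => rfl
  | noise ξ a k r ih => simp [append, ih]
  | kernel i a n s r _ ih => simp [append, ih]

@[simp] theorem bind_attach_nil (n : Fin d → ℕ) (h : PTree d κ ι → W) :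
    bind (attach K nil n) h = h (n, nil) := by
  simp [attach]

@[simp] theorem bind_attach_noise (ξ : ι) (a k n : Fin d → ℕ) (r : Forest d κ ι)
    (h : PTree d κ ι → W) : bind (attach K (noise ξ a k r) n) h = 0 := by
  simp [attach]

/-- The two constraints on ℓ are separated: ℓ ≤ n is part of the binomial splitting of n, and ℓ ≤ a
is imposed by `lower`. The coproduct identities for X^n thereby become applicable. -/
theorem bind_attach_kernel (i : κ) (a m n : Fin d → ℕ) (s r : Forest d κ ι)
    (h : PTree d κ ι → W) :
    bind (attach K (kernel i a m s r) n) h =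
      bind₂ (msplit K n) fun l n' => bind (lower K a l) fun a' =>
        bind (attach K r n') fun p => h (p.1, kernel i a' m s p.2) := by
  classical
  rw [attach, bind_sum, bind₂_msplit]
  have h1 : Finset.Icc 0 (n ⊓ a) = (Finset.Icc 0 n).filter (· ≤ a) := by
    ext l; simp
  rw [h1, Finset.sum_filter]
  refine Finset.sum_congr rfl fun l _ => ?_
  by_cases hl : l ≤ a
  · simp only [hl, if_true, lower, bind_pure]
    rw [← bind_fun_smul, bind_eq_sum (attach K r (n - l)), Finsupp.sum, Finsupp.sum, bind_sum]
    refine Finset.sum_congr rfl fun p _ => ?_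
    rw [bind_single, mul_comm, mul_smul]
  · simp [hl, lower]

/-- The root part of a deformed grafting: `X^m ω` is grafted onto a single vertex. -/
def attachTree (x : PTree d κ ι) (n : Fin d → ℕ) : PTree d κ ι →₀ K :=
  bind (attach K x.2 n) fun q => Finsupp.single (q.1 + x.1, q.2) 1

theorem bind_attachTree (x : PTree d κ ι) (n : Fin d → ℕ) (h : PTree d κ ι → W) :
    bind (attachTree (K := K) x n) h = bind (attach K x.2 n) fun q => h (q.1 + x.1, q.2) := by
  simp only [attachTree, bind_bind, bind_pure]

theorem bind_graftRoot (F : (Fin d → ℕ) → Forest d κ ι → (Forest d κ ι →₀ K))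
    (x : PTree d κ ι) (n : Fin d → ℕ) (h : PTree d κ ι → W) :
    bind (graftRoot K F x.1 x.2 n) h =
      bind₂ (cop K x) fun y z => bind (attachTree (K := K) y n) fun q =>
        bind (F z.1 z.2) fun u => h (q.1, q.2.append u) := by
  rw [graftRoot, bind_sum, bind₂_cop, bind₂_msplit]
  refine Finset.sum_congr rfl fun m₁ _ => ?_
  rw [bind_list_sum, bind₂_dsh, List.smul_sum, List.map_map, List.map_map]
  congr 1
  refine List.map_congr_left fun p _ => ?_
  simp only [Function.comp_apply, bind_attachTree]
  rw [← bind_fun_smul, bind_eq_sum (attach K p.1 n), Finsupp.sum, Finsupp.sum, bind_sum]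
  refine Finset.sum_congr rfl fun q _ => ?_
  rw [Finsupp.sum, bind_sum, bind_eq_sum, Finsupp.sum, Finset.smul_sum, Finset.smul_sum]
  refine Finset.sum_congr rfl fun u _ => ?_
  rw [bind_single, smul_smul, smul_smul]
  congr 1; ring

/-- The deformed grafting of `x` onto the non-root vertices of a forest. -/
def graft (η : Forest d κ ι) (x : PTree d κ ι) : Forest d κ ι →₀ K := graftForest K η x.1 x.2

theorem bind_glAct (x y : PTree d κ ι) (h : PTree d κ ι → W) :
    bind (glAct K x y) h =
      bind₂ (cop K x) fun x₁ x₂ => bind (attachTree (K := K) x₁ y.1) fun q =>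
        bind (graft (K := K) y.2 x₂) fun u => h (q.1, q.2.append u) :=
  bind_graftRoot _ _ _ _

open Classical in
theorem bind_graft_nil (x : PTree d κ ι) (h : Forest d κ ι → W) :
    bind (graft (K := K) nil x) h = if x = (0, nil) then h nil else 0 := by
  obtain ⟨m, ω⟩ := x
  cases ω with
  | nil => by_cases hm : m = 0 <;> simp [graft, graftForest, hm]
  | noise => simp [graft, graftForest]
  | kernel => simp [graft, graftForest]

theorem bind_graft_noise (ξ : ι) (a k : Fin d → ℕ) (r : Forest d κ ι) (x : PTree d κ ι)
    (h : Forest d κ ι → W) :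
    bind (graft (K := K) (noise ξ a k r) x) h =
      bind (graft (K := K) r x) fun u => h (noise ξ a k u) := by
  rw [graft, graftForest, sum_single_eq_bind, bind_bind]
  simp only [bind_pure]
  rfl

theorem bind_graft_kernel (i : κ) (a n : Fin d → ℕ) (s r : Forest d κ ι) (x : PTree d κ ι)
    (h : Forest d κ ι → W) :
    bind (graft (K := K) (kernel i a n s r) x) h =
      bind₂ (cop K x) fun x₁ x₂ => bind (glAct K x₁ (n, s)) fun t =>
        bind (graft (K := K) r x₂) fun u => h (kernel i a t.1 t.2 u) := by
  rw [graft, graftForest, bind_sum, bind₂_cop, bind₂_msplit]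
  refine Finset.sum_congr rfl fun m₁ _ => ?_
  rw [bind_list_sum, bind₂_dsh, List.smul_sum, List.map_map, List.map_map]
  congr 1
  refine List.map_congr_left fun p _ => ?_
  simp only [Function.comp_apply]
  rw [← bind_fun_smul, bind_eq_sum (glAct K _ _), Finsupp.sum, Finsupp.sum, bind_sum]
  refine Finset.sum_congr rfl fun q _ => ?_
  rw [Finsupp.sum, bind_sum, bind_eq_sum, Finsupp.sum, Finset.smul_sum, Finset.smul_sum]
  refine Finset.sum_congr rfl fun u _ => ?_
  rw [bind_single, smul_smul, smul_smul]
  congr 1; simp only [glAct, graft]; ring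

/-- The empty forest has no vertex and accepts only the unit, so this is the counit axiom:
everything goes to the other factor. -/
theorem bind₂_cop_graft_nil (x : PTree d κ ι) (h : PTree d κ ι → Forest d κ ι → W) :
    (bind₂ (cop K x) fun x₁ x₂ => bind (graft (K := K) nil x₁) fun u => h x₂ u) = h x nil := by
  classical
  have H : ∀ (ω : Forest d κ ι) (g : Forest d κ ι → W),
      (bind₂ (dsh K ω) fun u v => if u = nil then g v else 0) = g ω := by
    intro ω
    induction ω with
    | nil => simp
    | noise ξ a k r ih => intro g; simp [bind₂_dsh_noise, ih]
    | kernel i a n s r _ ih => intro g; simp [bind₂_dsh_kernel, ih]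
  simp only [bind_graft_nil, bind₂_cop, Prod.mk.injEq, ite_and]
  obtain ⟨m, ω⟩ := x
  have : ∀ a b : Fin d → ℕ, (bind₂ (dsh K ω) fun u v =>
      if a = 0 then if u = nil then h (b, v) nil else 0 else 0) =
      if a = 0 then h (b, ω) nil else 0 := by
    intro a b
    by_cases ha : a = 0
    · simp [ha, H ω fun v => h (b, v) nil]
    · simp [ha]
  simp only [this]
  exact bind₂_msplit_counit m fun b => h (b, ω) nil

end Products

attribute [irreducible] dsh cop attachTree graft

/-! ### Associativity of the deformed Grossman–Larson action -/

section GrossmanLarson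

variable {K : Type*} [Field K] {d : ℕ} {κ ι : Type*} {W : Type*} [AddCommGroup W] [Module K W]

theorem bind₂_msplit_left_comm (m : Fin d → ℕ)
    (h : (Fin d → ℕ) → (Fin d → ℕ) → (Fin d → ℕ) → W) :
    (bind₂ (msplit K m) fun a q => bind₂ (msplit K q) fun b c => h a b c) =
      bind₂ (msplit K m) fun b q => bind₂ (msplit K q) fun a c => h a b c := by
  rw [← bind₂_msplit_coassoc, ← bind₂_msplit_coassoc m fun b a c => h a b c]
  congr 1; ext p c
  rw [bind₂_msplit_comm]

theorem bind₂_cop_left_comm (x : PTree d κ ι)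
    (h : PTree d κ ι → PTree d κ ι → PTree d κ ι → W) :
    (bind₂ (cop K x) fun a q => bind₂ (cop K q) fun b c => h a b c) =
      bind₂ (cop K x) fun b q => bind₂ (cop K q) fun a c => h a b c := by
  rw [← bind₂_cop_coassoc, ← bind₂_cop_coassoc x fun b a c => h a b c]
  congr 1; ext p c
  rw [bind₂_cop_comm]

theorem bind₂_cop_interchange (x : PTree d κ ι)
    (h : PTree d κ ι → PTree d κ ι → PTree d κ ι → PTree d κ ι → W) :
    (bind₂ (cop K x) fun p q => bind₂ (cop K p) fun a b => bind₂ (cop K q) fun c e => h a b c e) =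
      bind₂ (cop K x) fun p q => bind₂ (cop K p) fun a c => bind₂ (cop K q) fun b e =>
        h a b c e := by
  rw [bind₂_cop_coassoc x fun a b q => bind₂ (cop K q) fun c e => h a b c e,
    bind₂_cop_coassoc x fun a c q => bind₂ (cop K q) fun b e => h a b c e]
  congr 1; ext a q
  rw [bind₂_cop_left_comm]

theorem bind_graft_append (ω η : Forest d κ ι) (x : PTree d κ ι) (h : Forest d κ ι → W) :
    bind (graft (K := K) (ω.append η) x) h =
      bind₂ (cop K x) fun x₁ x₂ => bind (graft (K := K) ω x₁) fun u =>
        bind (graft (K := K) η x₂) fun v => h (u.append v) := by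
  induction ω generalizing x h with
  | nil => rw [bind₂_cop_graft_nil x fun y u => bind (graft (K := K) η y) fun v => h (u.append v)]
           rfl
  | noise ξ a k r ih => simp only [append, bind_graft_noise, ih]
  | kernel i a n s r _ ih =>
    simp only [append, bind_graft_kernel, ih]
    simp only [bind_bind₂_comm _ (cop K _)]
    rw [← bind₂_cop_coassoc]

/-- Each branch of ω carries its own share of x, so splitting the branches after the grafting also
splits x. A branch sent to the right factor needs cocommutativity to move its share past the others.
-/
theorem bind_graft_dsh (ω : Forest d κ ι) (x : PTree d κ ι)
    (h : Forest d κ ι → Forest d κ ι → W) :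
    (bind (graft (K := K) ω x) fun u => bind₂ (dsh K u) h) =
      bind₂ (cop K x) fun x₁ x₂ => bind₂ (dsh K ω) fun ω₁ ω₂ =>
        bind (graft (K := K) ω₁ x₁) fun u₁ => bind (graft (K := K) ω₂ x₂) fun u₂ => h u₁ u₂ := by
  induction ω generalizing x h with
  | nil =>
    simp only [bind₂_dsh_nil]
    rw [bind₂_cop_graft_nil x fun y u => bind (graft (K := K) nil y) fun v => h u v]
    classical
    simp only [bind_graft_nil, bind₂_dsh_nil]
  | noise ξ a k r ih =>
    simp only [bind_graft_noise, bind₂_dsh_noise]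
    rw [ih]
    simp only [bind_fun_add]
  | kernel i a n s r _ ih =>
    simp only [bind_graft_kernel, bind₂_dsh_kernel, ih]
    simp only [bind_bind₂_comm _ (cop K _), bind_bind₂_comm _ (dsh K _),
      bind₂_comm (dsh K _) (cop K _), bind₂_fun_add, bind_fun_add]
    congr 1
    · rw [bind₂_cop_coassoc]
    · rw [bind₂_cop_left_comm]
      congr 1; ext y q
      congr 1; ext b c
      congr 1; ext r₁ r₂
      rw [bind_comm]

/-- The deformations ℓ of different branches draw on the decoration n independently. Dividing the
branches and the remaining decoration into two groups is thus the same as dividing n beforehand. -/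
theorem bind_attach_cop (ω : Forest d κ ι) (n : Fin d → ℕ)
    (h : (Fin d → ℕ) → (Fin d → ℕ) → Forest d κ ι → Forest d κ ι → W) :
    (bind (attach K ω n) fun q => bind₂ (msplit K q.1) fun a b => bind₂ (dsh K q.2) fun u v =>
        h a b u v) =
      bind₂ (msplit K n) fun n₁ n₂ => bind₂ (dsh K ω) fun ω₁ ω₂ =>
        bind (attach K ω₁ n₁) fun q₁ => bind (attach K ω₂ n₂) fun q₂ =>
          h q₁.1 q₂.1 q₁.2 q₂.2 := by
  induction ω generalizing n h with
  | nil => simp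
  | noise ξ a k r ih => simp [bind₂_dsh_noise]
  | kernel i a m s r _ ih =>
    simp only [bind_attach_kernel, bind₂_dsh_kernel]
    simp only [ih]
    simp only [bind_bind₂_comm _ (msplit K _), bind_bind₂_comm _ (dsh K _),
      bind₂_comm (dsh K _) (msplit K _), bind₂_fun_add, bind_fun_add]
    congr 1
    · rw [bind₂_msplit_coassoc]
    · rw [bind₂_msplit_left_comm]
      congr 1; ext y q
      congr 1; ext b c
      congr 1; ext r₁ r₂
      rw [bind_comm]

theorem bind_attachTree_cop (x : PTree d κ ι) (n : Fin d → ℕ)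
    (h : PTree d κ ι → PTree d κ ι → W) :
    (bind (attachTree (K := K) x n) fun q => bind₂ (cop K q) h) =
      bind₂ (cop K x) fun x₁ x₂ => bind₂ (msplit K n) fun n₁ n₂ =>
        bind (attachTree (K := K) x₁ n₁) fun q₁ => bind (attachTree (K := K) x₂ n₂) fun q₂ =>
          h q₁ q₂ := by
  simp only [bind_attachTree, bind₂_cop, bind₂_msplit_add, bind₂_comm (msplit K x.1) (dsh K _)]
  rw [bind_attach_cop x.2 n fun a b u v => bind₂ (msplit K x.1) fun a' b' =>
    h (a + a', u) (b + b', v)]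
  simp only [bind_bind₂_comm _ (msplit K x.1), bind₂_comm _ (msplit K x.1)]
  congr 1; ext a b
  rw [bind₂_comm]

/-- The two operations commute because they touch different data: attaching changes the edges at the
root, grafting onto ω happens above these edges. -/
theorem bind_graft_attach (ω : Forest d κ ι) (n : Fin d → ℕ) (x : PTree d κ ι)
    (h : (Fin d → ℕ) → Forest d κ ι → W) :
    (bind (attach K ω n) fun q => bind (graft (K := K) q.2 x) fun u => h q.1 u) =
      bind (graft (K := K) ω x) fun ω' => bind (attach K ω' n) fun q => h q.1 q.2 := by
  classical
  induction ω generalizing n x h with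
  | nil => simp [bind_graft_nil]
  | noise ξ a k r ih => simp [bind_graft_noise]
  | kernel i a m s r _ ih =>
    simp only [bind_attach_kernel, bind_graft_kernel]
    simp only [bind_bind₂_comm _ (cop K _), bind_bind₂_comm _ (msplit K _),
      bind₂_comm (msplit K _) (cop K _)]
    congr 1; ext x₁ x₂
    congr 1; ext l n'
    simp only [bind_comm _ (lower K _ _)]
    congr 1; ext a'
    rw [bind_comm]
    congr 1; ext t
    rw [ih _ _ fun b u => h b (kernel i a' t.1 t.2 u)]

/-- Coassociativity of X^n: a part l of the decoration can be set aside before or after the branches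
of η have consumed theirs. -/
theorem bind_attach_msplit (η : Forest d κ ι) (n : Fin d → ℕ)
    (h : (Fin d → ℕ) → (Fin d → ℕ) → Forest d κ ι → W) :
    (bind (attach K η n) fun q => bind₂ (msplit K q.1) fun l n' => h l n' q.2) =
      bind₂ (msplit K n) fun l n' => bind (attach K η n') fun q => h l q.1 q.2 := by
  induction η generalizing n h with
  | nil => simp
  | noise ξ a k r ih => simp
  | kernel i a m s r _ ih =>
    simp only [bind_attach_kernel]
    simp only [fun a' p => ih p fun l n' u => h l n' (kernel i a' m s u)]
    simp only [bind_bind₂_comm _ (msplit K _)]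
    rw [bind₂_msplit_left_comm]

/-- The associativity at a single vertex. On the left a branch of ω is deformed twice, first at a
vertex with decoration m and then at one with decoration n. On the right it is deformed once, at the
vertex whose decoration is m plus what η leaves of n. Vandermonde's identity equates the weights. -/
theorem bind_attach_attach (ω η : Forest d κ ι) (m n : Fin d → ℕ)
    (h : (Fin d → ℕ) → Forest d κ ι → W) :
    (bind (attach K ω m) fun q => bind (attach K (q.2.append η) n) fun q' =>
        h (q'.1 + q.1) q'.2) =
      bind (attach K η n) fun q => bind (attach K ω (q.1 + m)) fun q' =>
        h q'.1 (q'.2.append q.2) := by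
  induction ω generalizing m n h with
  | nil => simp [append]
  | noise ξ a k r ih => simp
  | kernel i a n' s r _ ih =>
    simp only [bind_attach_kernel, append]
    simp only [bind₂_msplit_add, bind_bind₂_comm _ (msplit K n)]
    rw [bind_attach_msplit η n fun l₁ p u => bind₂ (msplit K m) fun l₂ m' =>
      bind (lower K a (l₁ + l₂)) fun a' => bind (attach K r (p + m')) fun q' =>
        h q'.1 (kernel i a' n' s (q'.2.append u))]
    rw [bind₂_comm]
    congr 1; ext l₁ p
    rw [bind_bind₂_comm]
    congr 1; ext l₂ m'
    -- The deformation l₂, drawn from m, lowers the edge first; l₁, drawn from n, comes second.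
    rw [add_comm l₁ l₂]
    simp only [bind_lower_add]
    rw [bind_comm (attach K η p)]
    congr 1; ext a₁
    rw [bind_comm, bind_comm (attach K η p)]
    congr 1; ext a₂
    exact ih _ _ fun b u => h b (kernel i a₂ n' s u)

theorem bind_glAct_append (n : Fin d → ℕ) (ω η : Forest d κ ι) (x : PTree d κ ι)
    (h : PTree d κ ι → W) :
    bind (glAct K x (n, ω.append η)) h =
      bind₂ (cop K x) fun x₁ x₂ => bind (glAct K x₁ (n, ω)) fun t =>
        bind (graft (K := K) η x₂) fun v => h (t.1, t.2.append v) := by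
  simp only [bind_glAct, bind_graft_append, append_assoc]
  simp only [bind_bind₂_comm _ (cop K _)]
  rw [← bind₂_cop_coassoc]

/-- The share of x grafted above the root of y commutes with attaching y; the share at the root
itself is handled by `bind_attach_attach`. -/
theorem bind_attachTree_glAct (x y : PTree d κ ι) (n : Fin d → ℕ) (h : PTree d κ ι → W) :
    (bind (attachTree (K := K) y n) fun q => bind (glAct K x q) h) =
      bind (glAct K x y) fun w => bind (attachTree (K := K) w n) h := by
  simp only [bind_glAct, bind_attachTree]
  simp only [bind_bind₂_comm _ (cop K _)]
  congr 1; ext x₁ x₂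
  simp only [bind_comm (attach K x₁.2 _) (graft _ x₂), ← add_assoc]
  refine (bind_graft_attach y.2 n x₂ fun b u => bind (attach K x₁.2 (b + y.1)) fun q =>
    h (q.1 + x₁.1, q.2.append u)).trans ?_
  congr 1; ext u
  exact (bind_attach_attach x₁.2 u y.1 n fun b v => h (b + x₁.1, v)).symm

/-- Both x and y are shared out between the two factors: the part of x at the root by
`bind_attachTree_cop`, the part above it by `bind_graft_dsh`. The four resulting pieces of x are
then regrouped by the middle-four interchange, which uses cocommutativity. -/
theorem bind_glAct_cop (x y : PTree d κ ι) (h : PTree d κ ι → PTree d κ ι → W) :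
    (bind (glAct K x y) fun w => bind₂ (cop K w) h) =
      bind₂ (cop K x) fun x₁ x₂ => bind₂ (cop K y) fun y₁ y₂ =>
        bind (glAct K x₁ y₁) fun u => bind (glAct K x₂ y₂) fun v => h u v := by
  have H : ∀ (q : PTree d κ ι) (u : Forest d κ ι), bind₂ (cop K (q.1, q.2.append u)) h =
      bind₂ (cop K q) fun q₁ q₂ => bind₂ (dsh K u) fun u₁ u₂ =>
        h (q₁.1, q₁.2.append u₁) (q₂.1, q₂.2.append u₂) := by
    intro q u
    simp only [bind₂_cop, bind₂_dsh_append]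
  have H' : ∀ (q : PTree d κ ι) (x₂ : PTree d κ ι),
      (bind (graft (K := K) y.2 x₂) fun u => bind₂ (cop K (q.1, q.2.append u)) h) =
      bind₂ (cop K q) fun q₁ q₂ => bind₂ (cop K x₂) fun x₁ x₂ => bind₂ (dsh K y.2) fun ω₁ ω₂ =>
        bind (graft (K := K) ω₁ x₁) fun u₁ => bind (graft (K := K) ω₂ x₂) fun u₂ =>
          h (q₁.1, q₁.2.append u₁) (q₂.1, q₂.2.append u₂) := by
    intro q x₂
    simp only [H, bind_bind₂_comm (graft _ _) (cop K _), bind_graft_dsh]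
  simp only [bind_glAct, H', bind_attachTree_cop, bind₂_cop y]
  simp only [bind_bind₂_comm _ (cop K _), bind₂_comm (dsh K _) (cop K _),
    bind₂_comm (msplit K _) (cop K _), bind_bind₂_comm _ (dsh K _)]
  refine (bind₂_cop_interchange x fun a b c e => bind₂ (msplit K y.1) fun n₁ n₂ =>
    bind₂ (dsh K y.2) fun s₁ s₂ => bind (attachTree (K := K) a n₁) fun q₁ =>
    bind (attachTree (K := K) b n₂) fun q₂ => bind (graft (K := K) s₁ c) fun u₁ =>
    bind (graft (K := K) s₂ e) fun u₂ =>
      h (q₁.1, q₁.2.append u₁) (q₂.1, q₂.2.append u₂)).trans ?_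
  simp only [bind_comm (attachTree (K := K) _ _) (graft (K := K) _ _)]

open Classical in
-- Grafting never loses branches, and without branches the root decorations simply add, so only the
-- unit acting on the unit can produce the unit. This settles the empty forest in the associativity
-- proof.
theorem bind_glAct_counit (x y : PTree d κ ι) (c : W) :
    (bind (glAct K x y) fun w => if w = (0, nil) then c else 0) =
      if x = (0, nil) ∧ y = (0, nil) then c else 0 := by
  rw [bind_glAct]
  obtain ⟨m, η⟩ := y
  cases η with
  | nil =>
    simp only [bind_comm (attachTree (K := K) _ _) (graft (K := K) _ _)]
    rw [bind₂_cop_comm, bind₂_cop_graft_nil x fun x' u => bind (attachTree (K := K) x' m) fun q =>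
      if (q.1, q.2.append u) = (0, nil) then c else 0]
    obtain ⟨n, ω⟩ := x
    simp only [bind_attachTree, append_nil]
    cases ω with
    | nil => simp [and_comm]
    | noise ξ a k r => simp
    | kernel i a k s r => simp [bind_attach_kernel]
  | noise ξ a k r =>
    have : ∀ u v : Forest d κ ι, u.append (noise ξ a k v) ≠ nil := by
      intro u v; cases u <;> simp [append]
    simp [bind_graft_noise, this]
  | kernel i a k s r =>
    have : ∀ (u v w : Forest d κ ι) (k), u.append (kernel i a k v w) ≠ nil := by
      intro u v w k; cases u <;> simp [append]
    simp [bind_graft_kernel, this]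

/-- Structural induction on z. To graft x onto y ∗₊ z means to split x and y over the places in z
and to let each piece of x act on the corresponding piece of y; by `bind_glAct_cop` these pieces are
exactly the splitting of x ∗₊ y. -/
theorem bind_glAct_glAct (x y z : PTree d κ ι) (h : PTree d κ ι → W) :
    (bind (glAct K y z) fun w => bind (glAct K x w) h) =
      bind (glAct K x y) fun w => bind (glAct K w z) h := by
  -- The passage from the branches to the whole tree, used both at the root of z and inside the
  -- induction, at the upper vertex of each kernel edge.
  have root : ∀ (n : Fin d → ℕ) (s : Forest d κ ι),
      (∀ (x y : PTree d κ ι) (h : Forest d κ ι → W),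
        (bind (graft (K := K) s y) fun w => bind (graft (K := K) w x) h) =
          bind (glAct K x y) fun w => bind (graft (K := K) s w) h) →
      ∀ (x y : PTree d κ ι) (h : PTree d κ ι → W),
        (bind (glAct K y (n, s)) fun w => bind (glAct K x w) h) =
          bind (glAct K x y) fun w => bind (glAct K w (n, s)) h := by
    intro n s ih x y h
    simp only [bind_glAct _ (n, s), bind_glAct_cop, bind_glAct_append]
    simp only [bind_bind₂_comm _ (cop K _)]
    rw [bind₂_comm]
    congr 1; ext x₁ x₂
    congr 1; ext y₁ y₂
    simp only [bind_comm (graft s y₂) (glAct K x₁ _), ih, bind_attachTree_glAct]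
    congr 1; ext w
    rw [bind_comm]
  have forest : ∀ (η : Forest d κ ι) (x y : PTree d κ ι) (h : Forest d κ ι → W),
      (bind (graft (K := K) η y) fun w => bind (graft (K := K) w x) h) =
        bind (glAct K x y) fun w => bind (graft (K := K) η w) h := by
    intro η
    induction η with
    | nil =>
      intro x y h
      classical
      simp only [bind_graft_nil]
      rw [bind_glAct_counit]
      split_ifs <;> simp_all
    | noise ξ a k r ih => intro x y h; simp only [bind_graft_noise, ih]
    | kernel i a n s r ihs ihr =>
      intro x y h
      simp only [bind_graft_kernel, bind_glAct_cop]
      simp only [bind_bind₂_comm _ (cop K _)]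
      rw [bind₂_comm]
      congr 1; ext x₁ x₂
      congr 1; ext y₁ y₂
      simp only [bind_comm (graft r y₂) (glAct K x₁ _), ihr, root n s ihs x₁ y₁]
      congr 1; ext w
      rw [bind_comm]
  exact root z.1 z.2 (forest z.2) x y h

end GrossmanLarson

/-! ### Insertion as a derivation -/

section Insertion

variable {K : Type*} [Field K] {d : ℕ} {κ ι : Type*} {W : Type*} [AddCommGroup W] [Module K W]

theorem rootNoise_deshuffle (ω : Forest d κ ι) :
    ∀ p ∈ deshuffle ω, p.1.rootNoise + p.2.rootNoise = ω.rootNoise := by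
  induction ω with
  | nil => simp [deshuffle, rootNoise]
  | noise ξ a k r ih =>
    intro p hp
    simp only [deshuffle, List.mem_append, List.mem_map] at hp
    rcases hp with ⟨q, hq, rfl⟩ | ⟨q, hq, rfl⟩ <;>
    · have := ih q hq
      simp only [rootNoise]
      omega
  | kernel i a n s r _ ih =>
    intro p hp
    simp only [deshuffle, List.mem_append, List.mem_map] at hp
    rcases hp with ⟨q, hq, rfl⟩ | ⟨q, hq, rfl⟩ <;>
    · have := ih q hq
      simp only [rootNoise]
      omega

theorem bind₂_cop_eq_zero {x : PTree d κ ι} (hx : x.2.rootNoise ≠ 0)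
    {h : PTree d κ ι → PTree d κ ι → W} (h₁ : ∀ u v, u.2.rootNoise ≠ 0 → h u v = 0)
    (h₂ : ∀ u v, v.2.rootNoise ≠ 0 → h u v = 0) : bind₂ (cop K x) h = 0 := by
  rw [bind₂_cop]
  convert bind₂_fun_zero _ with a b
  rw [bind₂_dsh, List.sum_eq_zero]
  simp only [List.mem_map, forall_exists_index, and_imp]
  rintro _ p hp rfl
  have := rootNoise_deshuffle _ p hp
  by_cases hu : p.1.rootNoise = 0
  · exact h₂ _ _ (by simp only; omega)
  · exact h₁ _ _ hu

theorem attach_eq_zero (ω : Forest d κ ι) (hω : ω.rootNoise ≠ 0) (n : Fin d → ℕ) :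
    attach K ω n = 0 := by
  induction ω generalizing n with
  | nil => simp [rootNoise] at hω
  | noise ξ a k r ih => simp [attach]
  | kernel i a m s r _ ih => simp [attach, ih hω]

theorem attachTree_eq_zero {x : PTree d κ ι} (hx : x.2.rootNoise ≠ 0) (n : Fin d → ℕ) :
    attachTree (K := K) x n = 0 := by
  rw [attachTree, attach_eq_zero _ hx, bind_zero]

theorem bind_graft_eq_zero (η : Forest d κ ι) {x : PTree d κ ι} (hx : x.2.rootNoise ≠ 0)
    (h : Forest d κ ι → W) : bind (graft (K := K) η x) h = 0 := by
  classical
  induction η generalizing x h with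
  | nil =>
    rw [bind_graft_nil, if_neg]
    rintro rfl
    simp [rootNoise] at hx
  | noise ξ a k r ih => rw [bind_graft_noise, ih hx]
  | kernel i a m s r ihs ihr =>
    rw [bind_graft_kernel]
    refine bind₂_cop_eq_zero hx (fun u v hu => ?_) (fun u v hv => ?_)
    · rw [bind_glAct]
      refine bind₂_cop_eq_zero hu (fun u v hu => ?_) (fun u v hv => ?_)
      · rw [attachTree_eq_zero hu, bind_zero]
      · simp only [ihs hv, bind_fun_zero]
    · simp only [ihr hv, bind_fun_zero]

/-- In every splitting a noise edge at the root of x lands in some piece, and no piece containing it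
can be grafted. The noise conditions in the definitions of insertion and of `deltaPlusZero` are
therefore automatic. -/
theorem glAct_eq_zero {x : PTree d κ ι} (hx : x.2.rootNoise ≠ 0) (y : PTree d κ ι) :
    glAct K x y = 0 := by
  rw [← bind_single_one (glAct K x y), bind_glAct]
  refine bind₂_cop_eq_zero hx (fun u v hu => ?_) (fun u v hv => ?_)
  · rw [attachTree_eq_zero hu, bind_zero]
  · simp only [bind_graft_eq_zero _ hv, bind_fun_zero]

theorem bind_insertionNonRoot (τ x : PTree d κ ι) (h : PTree d κ ι → W) :
    bind (insertionNonRoot K τ x) h = bind (insertForest K τ x.2) fun u => h (x.1, u) := by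
  simp only [insertionNonRoot, sum_single_eq_bind, bind_bind, bind_pure]

theorem insertion_eq (τ x : PTree d κ ι) :
    insertion K τ x = glAct K x τ + insertionNonRoot K τ x := by
  rw [insertion, insertRoot, insertionNonRoot]
  split_ifs with hx
  · rfl
  · rw [glAct_eq_zero hx]

theorem bind_insertForest_nil (τ : PTree d κ ι) (h : Forest d κ ι → W) :
    bind (insertForest K τ nil) h = 0 := by
  rw [insertForest, bind_zero]

theorem bind_insertForest_noise (τ : PTree d κ ι) (ξ : ι) (a k : Fin d → ℕ) (r : Forest d κ ι)
    (h : Forest d κ ι → W) :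
    bind (insertForest K τ (noise ξ a k r)) h =
      bind (insertForest K τ r) fun u => h (noise ξ a k u) := by
  simp only [insertForest, sum_single_eq_bind, bind_bind, bind_pure]

theorem bind_insertForest_kernel (τ : PTree d κ ι) (i : κ) (a n : Fin d → ℕ) (s r : Forest d κ ι)
    (h : Forest d κ ι → W) :
    bind (insertForest K τ (kernel i a n s r)) h =
      (bind (insertion K τ (n, s)) fun t => h (kernel i a t.1 t.2 r)) +
        bind (insertForest K τ r) fun u => h (kernel i a n s u) := by
  rw [insertForest, bind_add, sum_single_eq_bind _ fun u => kernel i a n s u,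
    sum_single_eq_bind _ fun t : PTree d κ ι => kernel i a t.1 t.2 r, bind_bind, bind_bind]
  simp only [bind_pure]
  rfl

theorem bind_insertForest_append (τ : PTree d κ ι) (ω η : Forest d κ ι) (h : Forest d κ ι → W) :
    bind (insertForest K τ (ω.append η)) h =
      (bind (insertForest K τ ω) fun u => h (u.append η)) +
        bind (insertForest K τ η) fun v => h (ω.append v) := by
  induction ω generalizing h with
  | nil => simp [append, bind_insertForest_nil]
  | noise ξ a k r ih => simp only [append, bind_insertForest_noise, ih]
  | kernel i a n s r _ ih => simp only [append, bind_insertForest_kernel, ih, add_assoc]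

theorem bind_insertForest_dsh (τ : PTree d κ ι) (ω : Forest d κ ι)
    (h : Forest d κ ι → Forest d κ ι → W) :
    (bind (insertForest K τ ω) fun u => bind₂ (dsh K u) h) =
      bind₂ (dsh K ω) fun u v => (bind (insertForest K τ u) fun u' => h u' v) +
        bind (insertForest K τ v) fun v' => h u v' := by
  induction ω generalizing h with
  | nil => simp [bind_insertForest_nil]
  | noise ξ a k r ih =>
    simp only [bind_insertForest_noise, bind₂_dsh_noise, ih, bind_fun_add, bind₂_fun_add]
    abel
  | kernel i a n s r _ ih =>
    simp only [bind_insertForest_kernel, bind₂_dsh_kernel, ih, bind_fun_add, bind₂_fun_add,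
      bind_bind₂_comm]
    abel

theorem bind_insertionNonRoot_cop (τ x : PTree d κ ι) (h : PTree d κ ι → PTree d κ ι → W) :
    (bind (insertionNonRoot K τ x) fun w => bind₂ (cop K w) h) =
      bind₂ (cop K x) fun u v => (bind (insertionNonRoot K τ u) fun u' => h u' v) +
        bind (insertionNonRoot K τ v) fun v' => h u v' := by
  simp only [bind_insertionNonRoot, bind₂_cop, bind_bind₂_comm _ (msplit K _),
    bind_insertForest_dsh]

/-- Attaching changes only the decorations of the edges at the root, while insertion off the root
changes only what lies above them. -/
theorem bind_attach_insertForest (τ : PTree d κ ι) (ω : Forest d κ ι) (n : Fin d → ℕ)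
    (h : (Fin d → ℕ) → Forest d κ ι → W) :
    (bind (attach K ω n) fun q => bind (insertForest K τ q.2) fun u => h q.1 u) =
      bind (insertForest K τ ω) fun u => bind (attach K u n) fun q => h q.1 q.2 := by
  induction ω generalizing n h with
  | nil => simp [bind_insertForest_nil]
  | noise ξ a k r ih => simp [bind_insertForest_noise]
  | kernel i a m s r _ ih =>
    simp only [bind_attach_kernel, bind_insertForest_kernel, bind_fun_add, bind₂_fun_add,
      bind_bind₂_comm _ (msplit K _), fun a' p => ih p fun b u => h b (kernel i a' m s u)]
    simp only [bind_comm (insertion K _ _) (lower K _ _), bind_comm (insertForest K _ _) (lower K _ _),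
      bind_comm (insertion K _ _) (attach K _ _)]

theorem bind_attachTree_insertionNonRoot (τ x : PTree d κ ι) (n : Fin d → ℕ)
    (h : PTree d κ ι → W) :
    (bind (attachTree (K := K) x n) fun q => bind (insertionNonRoot K τ q) h) =
      bind (insertionNonRoot K τ x) fun w => bind (attachTree (K := K) w n) h := by
  simp only [bind_attachTree, bind_insertionNonRoot]
  exact bind_attach_insertForest τ x.2 n fun b u => h (b + x.1, u)

/-- The Leibniz rule. Insertion at a vertex inherited from x commutes with grafting; insertion at a
vertex of y meets a subtree that has received part of x, and associativity moves that part outside.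
-/
theorem bind_glAct_insertion (τ x y : PTree d κ ι) (h : PTree d κ ι → W) :
    (bind (glAct K x y) fun w => bind (insertion K τ w) h) =
      (bind (insertionNonRoot K τ x) fun x' => bind (glAct K x' y) h) +
        bind (insertion K τ y) fun y' => bind (glAct K x y') h := by
  have root : ∀ (n : Fin d → ℕ) (s : Forest d κ ι),
      (∀ (x : PTree d κ ι) (h : Forest d κ ι → W),
        (bind (graft (K := K) s x) fun w => bind (insertForest K τ w) h) =
          (bind (insertionNonRoot K τ x) fun x' => bind (graft (K := K) s x') h) +
            bind (insertForest K τ s) fun s' => bind (graft (K := K) s' x) h) →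
      ∀ (x : PTree d κ ι) (h : PTree d κ ι → W),
        (bind (glAct K x (n, s)) fun w => bind (insertion K τ w) h) =
          (bind (insertionNonRoot K τ x) fun x' => bind (glAct K x' (n, s)) h) +
            bind (insertion K τ (n, s)) fun y' => bind (glAct K x y') h := by
    intro n s ih x h
    simp only [insertion_eq, bind_add, bind_fun_add]
    -- Insertion at the root of y: (x ∗₊ y) ∗₊ τ = x ∗₊ (y ∗₊ τ). Only insertions off the root
    -- remain.
    rw [← bind_glAct_glAct, add_left_comm]
    congr 1
    simp only [bind_glAct _ (n, s), bind_insertionNonRoot_cop]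
    rw [bind_insertionNonRoot]
    simp only [bind_glAct]
    have H : ∀ (q : PTree d κ ι) (u : Forest d κ ι),
        bind (insertionNonRoot K τ (q.1, q.2.append u)) h =
          (bind (insertionNonRoot K τ q) fun q' => h (q'.1, q'.2.append u)) +
            bind (insertForest K τ u) fun v => h (q.1, q.2.append v) := by
      intro q u
      simp only [bind_insertionNonRoot, bind_insertForest_append]
    simp only [H, bind_fun_add, bind₂_fun_add, ih, add_assoc]
    simp only [bind_bind₂_comm _ (cop K _)]
    congr 1
    · congr 1; ext x₁ x₂
      simp only [bind_comm (graft _ _) (insertionNonRoot K _ _), bind_attachTree_insertionNonRoot]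
    · congr 1
      · congr 1; ext x₁ x₂
        rw [bind_comm]
      · congr 1; ext x₁ x₂
        rw [bind_comm]
  have forest : ∀ (η : Forest d κ ι) (x : PTree d κ ι) (h : Forest d κ ι → W),
      (bind (graft (K := K) η x) fun w => bind (insertForest K τ w) h) =
        (bind (insertionNonRoot K τ x) fun x' => bind (graft (K := K) η x') h) +
          bind (insertForest K τ η) fun η' => bind (graft (K := K) η' x) h := by
    intro η
    induction η with
    | nil =>
      classical
      intro x h
      simp only [bind_graft_nil, bind_insertForest_nil, ite_self, add_zero, bind_insertionNonRoot]
      obtain ⟨m, ω⟩ := x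
      cases ω with
      | nil => simp [bind_insertForest_nil]
      | noise ξ a k r => simp [bind_insertForest_noise]
      | kernel i a k s r => simp [bind_insertForest_kernel]
    | noise ξ a k r ih =>
      intro x h
      simp only [bind_graft_noise, bind_insertForest_noise, ih]
    | kernel i a n s r ihs ihr =>
      intro x h
      simp only [bind_graft_kernel, bind_insertForest_kernel, bind_insertionNonRoot_cop,
        bind_fun_add, bind₂_fun_add, ihr]
      simp only [bind_comm (graft r _) (insertion K τ _), root n s ihs,
        bind_bind₂_comm _ (cop K _), bind₂_fun_add, add_assoc,
        bind_comm (glAct K _ (n, s)) (insertionNonRoot K τ _),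
        bind_comm (glAct K _ (n, s)) (insertForest K τ _)]
      abel
  exact root y.1 y.2 (forest y.2) x h

end Insertion

/-! ### Splitting monomials and picking factors -/

section Monomials

variable (K : Type*) [Field K] {A : Type*} {W : Type*} [AddCommGroup W] [Module K W]

/-- The coproduct of a monomial. -/
def monSplit (m : Multiset A) : (Multiset A × Multiset A) →₀ K :=
  (m.antidiagonal.map fun p => Finsupp.single p (1 : K)).sum

open Classical in
/-- All ways to take one factor out of a monomial. -/
def monPick (m : Multiset A) : (Multiset A × A) →₀ K :=
  (m.map fun a => Finsupp.single (m.erase a, a) (1 : K)).sum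

variable {K}

theorem bind_multiset_sum {B : Type*} (l : Multiset (B →₀ K)) (h : B → W) :
    bind l.sum h = (l.map fun e => bind e h).sum := by
  induction l using Multiset.induction with
  | empty => simp
  | cons a l ih => simp [bind_add, ih]

theorem bind₂_monSplit (m : Multiset A) (h : Multiset A → Multiset A → W) :
    bind₂ (monSplit K m) h = (m.antidiagonal.map fun p => h p.1 p.2).sum := by
  simp [monSplit, bind₂_eq, bind_multiset_sum]

open Classical in
theorem bind₂_monPick (m : Multiset A) (h : Multiset A → A → W) :
    bind₂ (monPick K m) h = (m.map fun a => h (m.erase a) a).sum := by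
  simp [monPick, bind₂_eq, bind_multiset_sum]

@[simp] theorem bind₂_monSplit_zero (h : Multiset A → Multiset A → W) :
    bind₂ (monSplit K 0) h = h 0 0 := by
  simp [bind₂_monSplit]

theorem bind₂_monSplit_cons (a : A) (m : Multiset A) (h : Multiset A → Multiset A → W) :
    bind₂ (monSplit K (a ::ₘ m)) h =
      bind₂ (monSplit K m) fun u v => h (a ::ₘ u) v + h u (a ::ₘ v) := by
  rw [bind₂_fun_add]
  simp [bind₂_monSplit, add_comm]

@[simp] theorem bind₂_monPick_zero (h : Multiset A → A → W) :
    bind₂ (monPick K 0) h = 0 := by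
  simp [bind₂_monPick]

theorem bind₂_monPick_cons (a : A) (m : Multiset A) (h : Multiset A → A → W) :
    bind₂ (monPick K (a ::ₘ m)) h = h m a + bind₂ (monPick K m) fun u b => h (a ::ₘ u) b := by
  classical
  rw [bind₂_monPick, bind₂_monPick, Multiset.map_cons, Multiset.sum_cons, Multiset.erase_cons_head]
  congr 2
  refine Multiset.map_congr rfl fun b hb => ?_
  rw [Multiset.erase_cons_tail_of_mem hb]

theorem bind₂_monPick_congr {m : Multiset A} {f h : Multiset A → A → W}
    (H : ∀ u a, a ::ₘ u = m → f u a = h u a) :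
    bind₂ (monPick K m) f = bind₂ (monPick K m) h := by
  classical
  rw [bind₂_monPick, bind₂_monPick]
  congr 1
  exact Multiset.map_congr rfl fun a ha => H _ _ (Multiset.cons_erase ha)

end Monomials

/-! ### Insertion into the factors of a monomial -/

section Derivation

variable (K : Type*) [Field K] {d : ℕ} {κ ι : Type*} {W : Type*} [AddCommGroup W] [Module K W]

/-- Insertion of `τ` into the factors of a monomial of trees, as a derivation. -/
def insertMon (τ : PTree d κ ι) (m : Multiset (PTree d κ ι)) : Multiset (PTree d κ ι) →₀ K :=
  bind₂ (monPick K m) fun u σ => bind (insertion K τ σ) fun ρ => Finsupp.single (ρ ::ₘ u) 1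

variable {K}

theorem bind_insertMon (τ : PTree d κ ι) (m : Multiset (PTree d κ ι))
    (h : Multiset (PTree d κ ι) → W) :
    bind (insertMon K τ m) h =
      bind₂ (monPick K m) fun u σ => bind (insertion K τ σ) fun ρ => h (ρ ::ₘ u) := by
  simp only [insertMon, bind_bind₂, bind_bind, bind_pure]

theorem bind_insertMon_zero (τ : PTree d κ ι) (h : Multiset (PTree d κ ι) → W) :
    bind (insertMon K τ 0) h = 0 := by
  rw [bind_insertMon, bind₂_monPick_zero]

theorem bind_insertMon_cons (τ σ : PTree d κ ι) (m : Multiset (PTree d κ ι))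
    (h : Multiset (PTree d κ ι) → W) :
    bind (insertMon K τ (σ ::ₘ m)) h =
      (bind (insertion K τ σ) fun ρ => h (ρ ::ₘ m)) +
        bind (insertMon K τ m) fun u => h (σ ::ₘ u) := by
  simp only [bind_insertMon, bind₂_monPick_cons, Multiset.cons_swap σ]

theorem bind_insertMon_congr {τ : PTree d κ ι} {m : Multiset (PTree d κ ι)}
    {f h : Multiset (PTree d κ ι) → W} (H : ∀ u, u.card = m.card → f u = h u) :
    bind (insertMon K τ m) f = bind (insertMon K τ m) h := by
  rw [bind_insertMon, bind_insertMon]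
  refine bind₂_monPick_congr fun u a hu => ?_
  congr 1; ext ρ
  exact H _ (by simp [← hu])

theorem bind_insertMon_split (τ : PTree d κ ι) (m : Multiset (PTree d κ ι))
    (h : Multiset (PTree d κ ι) → Multiset (PTree d κ ι) → W) :
    (bind (insertMon K τ m) fun u => bind₂ (monSplit K u) h) =
      bind₂ (monSplit K m) fun u v => (bind (insertMon K τ u) fun u' => h u' v) +
        bind (insertMon K τ v) fun v' => h u v' := by
  induction m using Multiset.induction generalizing h with
  | empty => simp [bind_insertMon_zero]
  | cons σ m ih =>
    simp only [bind_insertMon_cons, bind₂_monSplit_cons, ih, bind_fun_add, bind₂_fun_add,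
      bind_bind₂_comm]
    abel

theorem bind_insertMon_pick (τ : PTree d κ ι) (m : Multiset (PTree d κ ι))
    (h : Multiset (PTree d κ ι) → PTree d κ ι → W) :
    (bind (insertMon K τ m) fun u => bind₂ (monPick K u) h) =
      bind₂ (monPick K m) fun u σ => (bind (insertMon K τ u) fun u' => h u' σ) +
        bind (insertion K τ σ) fun ρ => h u ρ := by
  induction m using Multiset.induction generalizing h with
  | empty => simp [bind_insertMon_zero]
  | cons σ m ih =>
    simp only [bind_insertMon_cons, bind₂_monPick_cons, ih, bind_fun_add, bind₂_fun_add,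
      bind_bind₂_comm]
    abel

attribute [irreducible] monSplit monPick insertMon

end Derivation

/-! ### Simultaneous insertion and the cointeraction in dual form -/

section Action

variable (K : Type*) [Field K] {d : ℕ} {κ ι : Type*} {W : Type*} [AddCommGroup W] [Module K W]

/-- Insertion of a monomial of trees into pairwise distinct vertices of a tree with root
decoration `n`, given the insertion `F` into the non-root vertices. -/
def multiRoot (n : Fin d → ℕ) (F : Multiset (PTree d κ ι) → (Forest d κ ι →₀ K))
    (m : Multiset (PTree d κ ι)) : PTree d κ ι →₀ K :=
  (bind (F m) fun u => Finsupp.single (n, u) 1) +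
    bind₂ (monPick K m) fun v σ => bind (F v) fun u => glAct K (n, u) σ

open Classical in
/-- Insertion of a monomial of trees into pairwise distinct non-root vertices of a forest. -/
def multiForest : Forest d κ ι → Multiset (PTree d κ ι) → (Forest d κ ι →₀ K)
  | nil, m => if m = 0 then Finsupp.single nil 1 else 0
  | noise ξ a k r, m => bind (multiForest r m) fun u => Finsupp.single (noise ξ a k u) 1
  | kernel i a n s r, m =>
      bind₂ (monSplit K m) fun v w => bind (multiRoot K n (multiForest s) v) fun t =>
        bind (multiForest r w) fun u => Finsupp.single (kernel i a t.1 t.2 u) 1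

/-- Insertion of a monomial of trees into pairwise distinct vertices of a tree. -/
def multi (t : PTree d κ ι) (m : Multiset (PTree d κ ι)) : PTree d κ ι →₀ K :=
  multiRoot K t.1 (multiForest K t.2) m

/-- Insertion of a monomial of trees into pairwise distinct non-root vertices of a tree. -/
def multiNonRoot (t : PTree d κ ι) (m : Multiset (PTree d κ ι)) : PTree d κ ι →₀ K :=
  bind (multiForest K t.2 m) fun u => Finsupp.single (t.1, u) 1

variable {K}

theorem bind_multi (t : PTree d κ ι) (m : Multiset (PTree d κ ι)) (h : PTree d κ ι → W) :
    bind (multi K t m) h = (bind (multiForest K t.2 m) fun u => h (t.1, u)) +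
      bind₂ (monPick K m) fun v σ => bind (multiForest K t.2 v) fun u =>
        bind (glAct K (t.1, u) σ) h := by
  simp only [multi, multiRoot, bind_add, bind_bind, bind_bind₂, bind_pure]

theorem bind_multiNonRoot (t : PTree d κ ι) (m : Multiset (PTree d κ ι)) (h : PTree d κ ι → W) :
    bind (multiNonRoot K t m) h = bind (multiForest K t.2 m) fun u => h (t.1, u) := by
  simp only [multiNonRoot, bind_bind, bind_pure]

open Classical in
theorem bind_multiForest_nil (m : Multiset (PTree d κ ι)) (h : Forest d κ ι → W) :
    bind (multiForest K nil m) h = if m = 0 then h nil else 0 := by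
  rw [multiForest, bind_ite_zero, bind_pure]

theorem bind_multiForest_noise (ξ : ι) (a k : Fin d → ℕ) (r : Forest d κ ι)
    (m : Multiset (PTree d κ ι)) (h : Forest d κ ι → W) :
    bind (multiForest K (noise ξ a k r) m) h =
      bind (multiForest K r m) fun u => h (noise ξ a k u) := by
  simp only [multiForest, bind_bind, bind_pure]

theorem bind_multiForest_kernel (i : κ) (a n : Fin d → ℕ) (s r : Forest d κ ι)
    (m : Multiset (PTree d κ ι)) (h : Forest d κ ι → W) :
    bind (multiForest K (kernel i a n s r) m) h =
      bind₂ (monSplit K m) fun v w => bind (multi K (n, s) v) fun t =>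
        bind (multiForest K r w) fun u => h (kernel i a t.1 t.2 u) := by
  simp only [multiForest, bind_bind, bind_bind₂, bind_pure, multi]

/-- If the root is free, τ goes to the root or to a place off the root. If σ occupies the root, the
Leibniz rule sends τ off the root or into σ. A vertex that is still free contributes to τm, a vertex
of an inserted factor to the derivation term. -/
theorem bind_multi_of_forest (τ : PTree d κ ι) (n : Fin d → ℕ) (s : Forest d κ ι)
    (ih : ∀ (m : Multiset (PTree d κ ι)) (h : Forest d κ ι → W),
      (bind (multiForest K s m) fun u => bind (insertForest K τ u) h) =
        bind (multiForest K s (τ ::ₘ m)) h +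
          bind (insertMon K τ m) fun m' => bind (multiForest K s m') h)
    (m : Multiset (PTree d κ ι)) (h : PTree d κ ι → W) :
    (bind (multi K (n, s) m) fun u => bind (insertion K τ u) h) =
      bind (multi K (n, s) (τ ::ₘ m)) h +
        bind (insertMon K τ m) fun m' => bind (multi K (n, s) m') h := by
  simp only [bind_multi, bind_glAct_insertion, bind_insertionNonRoot, bind_fun_add,
    bind₂_fun_add, bind₂_monPick_cons, bind_insertMon_pick]
  simp only [ih, bind₂_fun_add]
  simp only [insertion_eq, bind_add, bind_fun_add, bind₂_fun_add, bind_insertionNonRoot, ih]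
  simp only [bind_comm (glAct K _ _) (multiForest K _ _), bind_comm (insertForest K _ _) (multiForest K _ _)]
  abel

theorem bind_multiForest_insertForest (τ : PTree d κ ι) (η : Forest d κ ι)
    (m : Multiset (PTree d κ ι)) (h : Forest d κ ι → W) :
    (bind (multiForest K η m) fun u => bind (insertForest K τ u) h) =
      bind (multiForest K η (τ ::ₘ m)) h +
        bind (insertMon K τ m) fun m' => bind (multiForest K η m') h := by
  induction η generalizing m h with
  | nil =>
    classical
    simp [bind_multiForest_nil, bind_insertForest_nil, bind_insertMon]
  | noise ξ a k r ih => simp only [bind_multiForest_noise, bind_insertForest_noise, ih]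
  | kernel i a n s r ihs ihr =>
    simp only [bind_multiForest_kernel, bind_insertForest_kernel, bind₂_monSplit_cons,
      bind_insertMon_split, bind_fun_add, bind₂_fun_add, ihr]
    simp only [bind_comm (multiForest K r _) (insertion K _ _),
      bind_comm (multi K _ _) (insertMon K _ _), bind_multi_of_forest τ n s (ihs), bind₂_fun_add]
    abel

/-- The Guin–Oudom rule τ ▹ (m ▹ t) = (τm) ▹ t + (τ ▹ m) ▹ t, which identifies simultaneous
insertion with the recursively defined action. -/
theorem bind_multi_insertion (τ t : PTree d κ ι) (m : Multiset (PTree d κ ι))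
    (h : PTree d κ ι → W) :
    (bind (multi K t m) fun u => bind (insertion K τ u) h) =
      bind (multi K t (τ ::ₘ m)) h +
        bind (insertMon K τ m) fun m' => bind (multi K t m') h :=
  bind_multi_of_forest τ t.1 t.2 (bind_multiForest_insertForest τ t.2) m h

theorem bind_multiNonRoot_insertion (τ t : PTree d κ ι) (m : Multiset (PTree d κ ι))
    (h : PTree d κ ι → W) :
    (bind (multiNonRoot K t m) fun u => bind (insertionNonRoot K τ u) h) =
      bind (multiNonRoot K t (τ ::ₘ m)) h +
        bind (insertMon K τ m) fun m' => bind (multiNonRoot K t m') h := by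
  simp only [bind_multiNonRoot, bind_insertionNonRoot]
  exact bind_multiForest_insertForest τ t.2 m _

theorem bind_multiForest_zero (η : Forest d κ ι) (h : Forest d κ ι → W) :
    bind (multiForest K η 0) h = h η := by
  induction η generalizing h with
  | nil => simp [bind_multiForest_nil]
  | noise ξ a k r ih => rw [bind_multiForest_noise, ih]
  | kernel i a n s r ihs ihr => simp [bind_multiForest_kernel, bind_multi, ihs, ihr]

theorem bind_multi_zero (t : PTree d κ ι) (h : PTree d κ ι → W) :
    bind (multi K t 0) h = h t := by
  simp [bind_multi, bind_multiForest_zero]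

theorem bind_multiNonRoot_zero (t : PTree d κ ι) (h : PTree d κ ι → W) :
    bind (multiNonRoot K t 0) h = h t := by
  simp [bind_multiNonRoot, bind_multiForest_zero]

/-- The cointeraction in dual form. -/
theorem bind_glAct_multi (x y : PTree d κ ι) (m : Multiset (PTree d κ ι)) (h : PTree d κ ι → W) :
    (bind (glAct K x y) fun w => bind (multi K w m) h) =
      bind₂ (monSplit K m) fun u v => bind (multiNonRoot K x u) fun x' =>
        bind (multi K y v) fun y' => bind (glAct K x' y') h := by
  generalize hn : m.card = n
  induction n generalizing m h with
  | zero =>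
    rw [Multiset.card_eq_zero] at hn
    subst hn
    simp [bind_multi_zero, bind_multiNonRoot_zero]
  | succ n ih =>
    obtain ⟨τ, m, rfl⟩ : ∃ τ m', m = τ ::ₘ m' := by
      obtain ⟨τ, hτ⟩ := Multiset.card_pos_iff_exists_mem.1 (by omega : 0 < m.card)
      exact ⟨τ, Multiset.exists_cons_of_mem hτ⟩
    rw [Multiset.card_cons, Nat.add_right_cancel_iff] at hn
    -- The rule read backwards expresses τm through monomials with one factor fewer.
    have H : ∀ w : PTree d κ ι, bind (multi K w (τ ::ₘ m)) h =
        (bind (multi K w m) fun u => bind (insertion K τ u) h) -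
          bind (insertMon K τ m) fun m' => bind (multi K w m') h := fun w =>
      eq_sub_of_add_eq (bind_multi_insertion τ w m h).symm
    simp only [H, bind_fun_sub]
    -- Inserting τ into a factor keeps the number of factors, so the induction hypothesis also
    -- covers the correction term.
    rw [ih m _ hn, bind_comm, bind_insertMon_congr fun u hu => ih u h (hu.trans hn),
      bind_insertMon_split, sub_eq_iff_eq_add]
    simp only [bind₂_monSplit_cons, bind_glAct_insertion, bind_fun_add, bind₂_fun_add]
    simp only [bind_comm (multi K _ _) (insertionNonRoot K _ _), bind_multi_insertion,
      bind_multiNonRoot_insertion, bind_fun_add, bind₂_fun_add,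
      bind_comm (multiNonRoot K _ _) (insertMon K _ _)]
    abel

end Action

/-! ### The Guin–Oudom actions are simultaneous insertions -/

section GuinOudom

variable {K : Type*} [Field K] {d : ℕ} {κ ι : Type*} {W : Type*} [AddCommGroup W] [Module K W]

/-- The monomial `τ₀ ⋯ τ_{n-1}`. -/
def monOf {A : Type*} {n : ℕ} (τ : Fin n → A) : Multiset A := Finset.univ.val.map τ

theorem monOf_cons {A : Type*} {n : ℕ} (τ : Fin (n + 1) → A) :
    monOf τ = τ 0 ::ₘ monOf (Fin.tail τ) := by
  rw [monOf, Fin.univ_succ, Finset.cons_val, Multiset.map_cons, Finset.map_val, Multiset.map_map]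
  rfl

theorem monOf_comp_perm {A : Type*} {n : ℕ} (τ : Fin n → A) (π : Equiv.Perm (Fin n)) :
    monOf (fun i => τ (π i)) = monOf τ := by
  have : (Finset.univ : Finset (Fin n)).val.map π = Finset.univ.val := by
    have := congrArg Finset.val (Finset.map_univ_equiv π)
    rwa [Finset.map_val] at this
  rw [monOf, monOf]
  conv_rhs => rw [← this, Multiset.map_map]
  rfl

theorem monOf_update {A : Type*} {n : ℕ} (τ : Fin n → A) (j : Fin n) (σ : A) :
    monOf (Function.update τ j σ) = σ ::ₘ (Finset.univ.erase j).val.map τ := by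
  rw [monOf, ← Finset.insert_erase (Finset.mem_univ j),
    Finset.insert_val_of_notMem (Finset.notMem_erase j _), Multiset.map_cons,
    Function.update_self, Finset.insert_erase (Finset.mem_univ j)]
  congr 1
  refine Multiset.map_congr rfl fun i hi => Function.update_of_ne ?_ _ _
  exact Finset.ne_of_mem_erase (show i ∈ Finset.univ.erase j from hi)

theorem bind_insertMon_monOf (τ : PTree d κ ι) {n : ℕ} (v : Fin n → PTree d κ ι)
    (h : Multiset (PTree d κ ι) → W) :
    bind (insertMon K τ (monOf v)) h =
      ∑ j, bind (insertion K τ (v j)) fun σ => h (monOf (Function.update v j σ)) := by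
  rw [bind_insertMon, bind₂_monPick, monOf, Multiset.map_map]
  refine congrArg Multiset.sum (Multiset.map_congr rfl fun j _ => ?_)
  simp only [Function.comp_apply, monOf_update]
  have : Finset.univ.val.map v = v j ::ₘ (Finset.univ.erase j).val.map v := by
    rw [← monOf_update v j, Function.update_eq_self]
    rfl
  rw [this, @Multiset.erase_cons_head _ (fun a b => Classical.propDecidable (a = b))]

/-- The recursion determines the action, so any solution indexed by multisets computes it.
Independence of the order of the factors is then immediate. -/
theorem act_eq_of_recursion {I : PTree d κ ι → PTree d κ ι → (PTree d κ ι →₀ K)}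
    {M : PTree d κ ι → Multiset (PTree d κ ι) → (PTree d κ ι →₀ K)}
    (h0 : ∀ t, M t 0 = Finsupp.single t 1)
    (hs : ∀ τ t m, bind (M t m) (I τ) =
      M t (τ ::ₘ m) + bind (insertMon K τ m) fun m' => M t m')
    (n : ℕ) (τ : Fin n → PTree d κ ι) (t : PTree d κ ι) :
    act K I n τ t = M t (monOf τ) := by
  induction n generalizing t with
  | zero => simp [act, monOf, h0]
  | succ n ih =>
    rw [act, monOf_cons, eq_sub_of_add_eq (hs (τ 0) t (monOf (Fin.tail τ))).symm,
      bind_insertMon_monOf]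
    simp only [ih, ← bind_eq_sum]

theorem act_insertion (n : ℕ) (τ : Fin n → PTree d κ ι) (t : PTree d κ ι) :
    act K (insertion K) n τ t = multi K t (monOf τ) := by
  refine act_eq_of_recursion (fun t => ?_) (fun τ t m => ?_) n τ t
  · rw [← bind_multi_zero (K := K) t fun u => Finsupp.single u (1 : K), bind_single_one]
  · have := bind_multi_insertion (K := K) τ t m fun u => Finsupp.single u (1 : K)
    simpa only [bind_single_one] using this

theorem act_insertionNonRoot (n : ℕ) (τ : Fin n → PTree d κ ι) (t : PTree d κ ι) :
    act K (insertionNonRoot K) n τ t = multiNonRoot K t (monOf τ) := by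
  refine act_eq_of_recursion (fun t => ?_) (fun τ t m => ?_) n τ t
  · rw [← bind_multiNonRoot_zero (K := K) t fun u => Finsupp.single u (1 : K), bind_single_one]
  · have := bind_multiNonRoot_insertion (K := K) τ t m fun u => Finsupp.single u (1 : K)
    simpa only [bind_single_one] using this

/-- The multiset of trees that underlies a monomial. -/
def monTrees {β : κ → ℝ} {α : ι → ℝ} (a : NegMon d β α) : Multiset (PTree d κ ι) :=
  (Finsupp.toMultiset a).map Subtype.val

theorem monOf_get {β : κ → ℝ} {α : ι → ℝ} (a : NegMon d β α) :
    monOf (fun i => ((Finsupp.toMultiset a).toList.get i).1) = monTrees a := by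
  have : (monOf fun i => (Finsupp.toMultiset a).toList.get i) = Finsupp.toMultiset a := by
    conv_rhs => rw [← (Finsupp.toMultiset a).coe_toList]
    rw [monOf, Fin.univ_val_map, List.ofFn_get]
  conv_rhs => rw [monTrees, ← this, monOf, Multiset.map_map]
  rfl

theorem actMon_insertion {β : κ → ℝ} {α : ι → ℝ} (a : NegMon d β α) (t : PTree d κ ι) :
    actMon K (insertion K) a t = multi K t (monTrees a) := by
  rw [actMon, act_insertion, monOf_get]

theorem actMon_insertionNonRoot {β : κ → ℝ} {α : ι → ℝ} (a : NegMon d β α) (t : PTree d κ ι) :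
    actMon K (insertionNonRoot K) a t = multiNonRoot K t (monTrees a) := by
  rw [actMon, act_insertionNonRoot, monOf_get]

end GuinOudom

/-! ### Labels and total decorations -/

section Size

variable {d : ℕ} {κ ι : Type*}

/-- The size `|a|` of a multi-index. -/
def deg (a : Fin d → ℕ) : ℕ := ∑ j, a j

theorem deg_add (a b : Fin d → ℕ) : deg (a + b) = deg a + deg b := Finset.sum_add_distrib

theorem deg_zero : deg (0 : Fin d → ℕ) = 0 := by simp [deg]

namespace Forest

/-- The multiset of kernels and noises on the edges. -/
def labels : Forest d κ ι → Multiset (κ ⊕ ι)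
  | nil => 0
  | noise ξ _ _ r => Sum.inr ξ ::ₘ labels r
  | kernel i _ _ s r => Sum.inl i ::ₘ (labels s + labels r)

/-- The total size of the edge decorations. -/
def edgeDeg : Forest d κ ι → ℕ
  | nil => 0
  | noise _ a _ r => deg a + edgeDeg r
  | kernel _ a _ s r => deg a + edgeDeg s + edgeDeg r

/-- The total size of the edge decorations without those of the edges at the root. -/
def innerEdgeDeg : Forest d κ ι → ℕ
  | nil => 0
  | noise _ _ _ r => innerEdgeDeg r
  | kernel _ _ _ s r => edgeDeg s + innerEdgeDeg r

/-- The total size of the vertex decorations. -/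
def vertexDeg : Forest d κ ι → ℕ
  | nil => 0
  | noise _ _ k r => deg k + vertexDeg r
  | kernel _ _ n s r => deg n + vertexDeg s + vertexDeg r

theorem innerEdgeDeg_le (ω : Forest d κ ι) : ω.innerEdgeDeg ≤ ω.edgeDeg := by
  induction ω with
  | nil => rfl
  | noise ξ a k r ih => simp only [innerEdgeDeg, edgeDeg]; omega
  | kernel i a n s r _ ih => simp only [innerEdgeDeg, edgeDeg]; omega

theorem labels_append (ω η : Forest d κ ι) : (ω.append η).labels = ω.labels + η.labels := by
  induction ω with
  | nil => simp [append, labels]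
  | noise ξ a k r ih => simp [append, labels, ih]
  | kernel i a n s r _ ih => simp [append, labels, ih, add_assoc]

theorem edgeDeg_append (ω η : Forest d κ ι) :
    (ω.append η).edgeDeg = ω.edgeDeg + η.edgeDeg := by
  induction ω with
  | nil => simp [append, edgeDeg]
  | noise ξ a k r ih => simp [append, edgeDeg, ih, add_assoc]
  | kernel i a n s r _ ih => simp [append, edgeDeg, ih, add_assoc]

theorem vertexDeg_append (ω η : Forest d κ ι) :
    (ω.append η).vertexDeg = ω.vertexDeg + η.vertexDeg := by
  induction ω with
  | nil => simp [append, vertexDeg]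
  | noise ξ a k r ih => simp [append, vertexDeg, ih, add_assoc]
  | kernel i a n s r _ ih => simp [append, vertexDeg, ih, add_assoc]

theorem rootNoise_append (ω η : Forest d κ ι) :
    (ω.append η).rootNoise = ω.rootNoise + η.rootNoise := by
  induction ω with
  | nil => simp [append, rootNoise]
  | noise ξ a k r ih => simp only [append, rootNoise, ih]; omega
  | kernel i a n s r _ ih => simp [append, rootNoise, ih]

theorem valid_append {ω η : Forest d κ ι} (h : ω.rootNoise = 0) (hω : ω.Valid) (hη : η.Valid) :
    (ω.append η).Valid := by
  induction ω with
  | nil => exact hη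
  | noise ξ a k r ih => simp [rootNoise] at h
  | kernel i a n s r _ ih => exact ⟨hω.1, ih h hω.2⟩

end Forest

/-- `p` is a splitting of the branches of `ω` with the same total sizes. -/
structure Splits (ω u v : Forest d κ ι) : Prop where
  labels : u.labels + v.labels = ω.labels
  edgeDeg : u.edgeDeg + v.edgeDeg = ω.edgeDeg
  innerEdgeDeg : u.innerEdgeDeg + v.innerEdgeDeg = ω.innerEdgeDeg
  vertexDeg : u.vertexDeg + v.vertexDeg = ω.vertexDeg
  valid : ω.Valid → u.Valid ∧ v.Valid

theorem splits_of_mem_deshuffle {ω : Forest d κ ι} {p : Forest d κ ι × Forest d κ ι}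
    (hp : p ∈ deshuffle ω) : Splits ω p.1 p.2 := by
  induction ω generalizing p with
  | nil =>
    simp only [deshuffle, List.mem_singleton] at hp
    subst hp
    constructor <;> simp [Forest.labels, Forest.edgeDeg, Forest.innerEdgeDeg, Forest.vertexDeg]
  | noise ξ a k r ih =>
    simp only [deshuffle, List.mem_append, List.mem_map] at hp
    rcases hp with ⟨q, hq, rfl⟩ | ⟨q, hq, rfl⟩ <;>
    · have h := ih hq
      have hr := rootNoise_deshuffle r q hq
      constructor
      · simp [Forest.labels, ← h.labels]
      · simp only [Forest.edgeDeg, ← h.edgeDeg]; omega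
      · simp only [Forest.innerEdgeDeg, ← h.innerEdgeDeg]
      · simp only [Forest.vertexDeg, ← h.vertexDeg]; omega
      · intro hv
        have h1 := h.valid hv.2
        have h2 : r.rootNoise = 0 := hv.1
        first
        | exact ⟨⟨by omega, h1.1⟩, h1.2⟩
        | exact ⟨h1.1, by omega, h1.2⟩
  | kernel i a n s r _ ih =>
    simp only [deshuffle, List.mem_append, List.mem_map] at hp
    rcases hp with ⟨q, hq, rfl⟩ | ⟨q, hq, rfl⟩ <;>
    · have h := ih hq
      constructor
      · simp only [Forest.labels, ← h.labels, ← Multiset.singleton_add]; abel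
      · simp only [Forest.edgeDeg, ← h.edgeDeg]; omega
      · simp only [Forest.innerEdgeDeg, ← h.innerEdgeDeg]; omega
      · simp only [Forest.vertexDeg, ← h.vertexDeg]; omega
      · intro hv
        have h1 := h.valid hv.2
        simp only [Valid, h1, hv.1, and_self]

end Size

/-! ### Conservation laws for grafting -/

section Support

variable {K : Type*} [Field K] {d : ℕ} {κ ι : Type*} {A B C : Type*}

theorem exists_of_mem_support_bind {e : A →₀ K} {h : A → B →₀ K} {b : B}
    (hb : b ∈ (bind e h).support) : ∃ a ∈ e.support, b ∈ (h a).support := by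
  by_contra! H
  refine Finsupp.mem_support_iff.1 hb ?_
  rw [bind_apply]
  refine Finset.sum_eq_zero fun a ha => ?_
  simp only [Finsupp.notMem_support_iff.1 (H a ha), mul_zero]

theorem exists_of_mem_support_bind₂ {e : (A × C) →₀ K} {h : A → C → B →₀ K} {b : B}
    (hb : b ∈ (bind₂ e h).support) : ∃ a c, (a, c) ∈ e.support ∧ b ∈ (h a c).support := by
  rw [bind₂_eq] at hb
  obtain ⟨p, hp, hb⟩ := exists_of_mem_support_bind hb
  exact ⟨p.1, p.2, hp, hb⟩

theorem eq_of_mem_support_single {a b : A} (h : b ∈ (Finsupp.single a (1 : K)).support) : b = a :=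
  Finset.mem_singleton.1 (Finsupp.support_single_subset h)

theorem exists_of_mem_support_list_sum {l : List (A →₀ K)} {a : A} (h : a ∈ l.sum.support) :
    ∃ e ∈ l, a ∈ e.support := by
  induction l with
  | nil => simp at h
  | cons e l ih =>
    classical
    rw [List.sum_cons] at h
    rcases Finset.mem_union.1 (Finsupp.support_add h) with h | h
    · exact ⟨e, by simp, h⟩
    · obtain ⟨f, hf, h⟩ := ih h
      exact ⟨f, by simp [hf], h⟩

theorem mem_deshuffle_of_mem_support {ω : Forest d κ ι} {p : Forest d κ ι × Forest d κ ι}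
    (hp : p ∈ (dsh K ω).support) : p ∈ deshuffle ω := by
  rw [dsh] at hp
  obtain ⟨e, he, hp⟩ := exists_of_mem_support_list_sum hp
  obtain ⟨q, hq, rfl⟩ := List.mem_map.1 he
  rwa [eq_of_mem_support_single hp]

theorem deg_of_mem_support_msplit {m : Fin d → ℕ} {p : (Fin d → ℕ) × (Fin d → ℕ)}
    (hp : p ∈ (msplit K m).support) : deg p.1 + deg p.2 = deg m := by
  classical
  rw [msplit] at hp
  obtain ⟨l, hl, hp⟩ := Finset.mem_biUnion.1 (Finsupp.support_finsetSum hp)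
  rw [Finset.mem_singleton.1 (Finsupp.support_single_subset hp), ← deg_add]
  exact congrArg deg (add_tsub_cancel_of_le (Finset.mem_Icc.1 hl).2)

theorem deg_of_mem_support_lower {a l b : Fin d → ℕ} (hb : b ∈ (lower K a l).support) :
    deg b + deg l = deg a := by
  rw [lower] at hb
  split_ifs at hb with h
  · rw [eq_of_mem_support_single hb, ← deg_add, tsub_add_cancel_of_le h]
  · simp at hb

theorem splits_of_mem_support_cop {x x₁ x₂ : PTree d κ ι} (h : (x₁, x₂) ∈ (cop K x).support) :
    deg x₁.1 + deg x₂.1 = deg x.1 ∧ Splits x.2 x₁.2 x₂.2 := by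
  rw [cop] at h
  obtain ⟨a, b, hab, h⟩ := exists_of_mem_support_bind₂ h
  obtain ⟨u, v, huv, h⟩ := exists_of_mem_support_bind₂ h
  cases eq_of_mem_support_single h
  exact ⟨deg_of_mem_support_msplit hab, splits_of_mem_deshuffle (mem_deshuffle_of_mem_support huv)⟩

/-- A deformation removes the same ℓ from an edge and from the vertex, and only edges at the root
are deformed. -/
theorem mem_support_attach {ω : Forest d κ ι} {n : Fin d → ℕ} {q : PTree d κ ι}
    (hq : q ∈ (attach K ω n).support) :
    q.2.labels = ω.labels ∧ q.2.innerEdgeDeg = ω.innerEdgeDeg ∧ q.2.vertexDeg = ω.vertexDeg ∧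
      q.2.edgeDeg + deg n = ω.edgeDeg + deg q.1 ∧ q.2.rootNoise = 0 ∧
      (ω.Valid → q.2.Valid) := by
  induction ω generalizing n q with
  | nil =>
    rw [attach] at hq
    cases eq_of_mem_support_single hq
    simp [rootNoise]
  | noise ξ a k r ih => simp [attach] at hq
  | kernel i a m s r _ ih =>
    rw [← bind_single_one (attach K (kernel i a m s r) n), bind_attach_kernel] at hq
    obtain ⟨l, n', hl, hq⟩ := exists_of_mem_support_bind₂ hq
    obtain ⟨a', ha', hq⟩ := exists_of_mem_support_bind hq
    obtain ⟨p, hp, hq⟩ := exists_of_mem_support_bind hq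
    cases eq_of_mem_support_single hq
    obtain ⟨h1, h2, h3, h4, h5, h6⟩ := ih hp
    have hl := deg_of_mem_support_msplit hl
    have ha := deg_of_mem_support_lower ha'
    refine ⟨by simp [labels, h1], by simp [innerEdgeDeg, h2], by simp [vertexDeg, h3], ?_, h5,
      fun h => ⟨h.1, h6 h.2⟩⟩
    simp only [edgeDeg] at *
    omega

theorem exists_of_mem_support_glAct {x y z : PTree d κ ι} (hz : z ∈ (glAct K x y).support) :
    ∃ x₁ x₂ q u, (x₁, x₂) ∈ (cop K x).support ∧ q ∈ (attach K x₁.2 y.1).support ∧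
      u ∈ (graft (K := K) y.2 x₂).support ∧ z = (q.1 + x₁.1, q.2.append u) := by
  rw [← bind_single_one (glAct K x y), bind_glAct] at hz
  simp only [bind_attachTree] at hz
  obtain ⟨x₁, x₂, hx, hz⟩ := exists_of_mem_support_bind₂ hz
  obtain ⟨q, hq, hz⟩ := exists_of_mem_support_bind hz
  obtain ⟨u, hu, hz⟩ := exists_of_mem_support_bind hz
  exact ⟨x₁, x₂, q, u, hx, hq, hu, eq_of_mem_support_single hz⟩

/-- Only the edges at the root of x lose decoration, and only vertices of y pay for it; the
inequalities record what survives. The hypothesis `ih` is the statement for the branches of y, so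
that the induction on forests can apply this at each upper vertex. -/
theorem mem_support_glAct_of_graft {x y z : PTree d κ ι}
    (ih : ∀ {x : PTree d κ ι} {u : Forest d κ ι}, u ∈ (graft (K := K) y.2 x).support →
      u.labels = x.2.labels + y.2.labels ∧
      x.2.edgeDeg + y.2.edgeDeg + u.vertexDeg =
        u.edgeDeg + (deg x.1 + x.2.vertexDeg) + y.2.vertexDeg ∧
      y.2.edgeDeg + x.2.innerEdgeDeg ≤ u.edgeDeg ∧ deg x.1 + x.2.vertexDeg ≤ u.vertexDeg ∧
      u.rootNoise = y.2.rootNoise ∧ (x.2.Valid → y.2.Valid → u.Valid))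
    (hz : z ∈ (glAct K x y).support) :
    z.2.labels = x.2.labels + y.2.labels ∧
      x.2.edgeDeg + y.2.edgeDeg + (deg z.1 + z.2.vertexDeg) =
        z.2.edgeDeg + (deg x.1 + x.2.vertexDeg) + (deg y.1 + y.2.vertexDeg) ∧
      y.2.edgeDeg + x.2.innerEdgeDeg ≤ z.2.edgeDeg ∧
      deg x.1 + x.2.vertexDeg ≤ deg z.1 + z.2.vertexDeg ∧
      z.2.rootNoise = y.2.rootNoise ∧ (x.2.Valid → y.2.Valid → z.2.Valid) := by
  obtain ⟨x₁, x₂, q, u, hx, hq, hu, rfl⟩ := exists_of_mem_support_glAct hz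
  obtain ⟨hd, hs⟩ := splits_of_mem_support_cop hx
  obtain ⟨a1, a2, a3, a4, a5, a6⟩ := mem_support_attach hq
  obtain ⟨g1, g2, g3, g4, g5, g6⟩ := ih hu
  have s2 := hs.edgeDeg
  have s3 := hs.innerEdgeDeg
  have s4 := hs.vertexDeg
  have i1 := innerEdgeDeg_le q.2
  simp only [labels_append, edgeDeg_append, vertexDeg_append, rootNoise_append, deg_add]
  refine ⟨?_, by omega, by omega, by omega, by omega, fun hx hy => ?_⟩
  · rw [a1, g1, ← hs.labels, add_assoc]
  · exact valid_append a5 (a6 (hs.valid hx).1) (g6 (hs.valid hx).2 hy)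

theorem mem_support_graft {η : Forest d κ ι} {x : PTree d κ ι} {u : Forest d κ ι}
    (hu : u ∈ (graft (K := K) η x).support) :
    u.labels = x.2.labels + η.labels ∧
      x.2.edgeDeg + η.edgeDeg + u.vertexDeg =
        u.edgeDeg + (deg x.1 + x.2.vertexDeg) + η.vertexDeg ∧
      η.edgeDeg + x.2.innerEdgeDeg ≤ u.edgeDeg ∧ deg x.1 + x.2.vertexDeg ≤ u.vertexDeg ∧
      u.rootNoise = η.rootNoise ∧ (x.2.Valid → η.Valid → u.Valid) := by
  induction η generalizing x u with
  | nil =>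
    classical
    rw [← bind_single_one (graft nil x), bind_graft_nil] at hu
    split_ifs at hu with h
    · cases eq_of_mem_support_single hu
      subst h
      simp [labels, edgeDeg, vertexDeg, innerEdgeDeg, deg_zero, rootNoise, Valid]
    · simp at hu
  | noise ξ a k r ih =>
    rw [← bind_single_one (graft (noise ξ a k r) x), bind_graft_noise] at hu
    obtain ⟨v, hv, hu⟩ := exists_of_mem_support_bind hu
    cases eq_of_mem_support_single hu
    obtain ⟨g1, g2, g3, g4, g5, g6⟩ := ih hv
    simp only [labels, edgeDeg, vertexDeg, rootNoise, Valid]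
    refine ⟨by simp [g1], by omega, by omega, by omega, by omega, fun hx hy => ?_⟩
    exact ⟨g5.trans hy.1, g6 hx hy.2⟩
  | kernel i a n s r ihs ihr =>
    rw [← bind_single_one (graft (kernel i a n s r) x), bind_graft_kernel] at hu
    obtain ⟨x₁, x₂, hx, hu⟩ := exists_of_mem_support_bind₂ hu
    obtain ⟨t, ht, hu⟩ := exists_of_mem_support_bind hu
    obtain ⟨v, hv, hu⟩ := exists_of_mem_support_bind hu
    cases eq_of_mem_support_single hu
    obtain ⟨hd, hs⟩ := splits_of_mem_support_cop hx
    obtain ⟨g1, g2, g3, g4, g5, g6⟩ := ihr hv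
    obtain ⟨t1, t2, t3, t4, t5, t6⟩ := mem_support_glAct_of_graft (y := (n, s)) ihs ht
    have s2 := hs.edgeDeg
    have s3 := hs.innerEdgeDeg
    have s4 := hs.vertexDeg
    simp only [labels, edgeDeg, vertexDeg, rootNoise, Valid] at *
    refine ⟨?_, by omega, by omega, by omega, by omega, fun hx hy => ?_⟩
    · simp only [g1, t1, ← hs.labels, ← Multiset.singleton_add]; abel
    · exact ⟨t6 (hs.valid hx).1 hy.1, g6 (hs.valid hx).2 hy.2⟩

theorem mem_support_glAct {x y z : PTree d κ ι} (hz : z ∈ (glAct K x y).support) :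
    z.2.labels = x.2.labels + y.2.labels ∧
      x.2.edgeDeg + y.2.edgeDeg + (deg z.1 + z.2.vertexDeg) =
        z.2.edgeDeg + (deg x.1 + x.2.vertexDeg) + (deg y.1 + y.2.vertexDeg) ∧
      y.2.edgeDeg + x.2.innerEdgeDeg ≤ z.2.edgeDeg ∧
      deg x.1 + x.2.vertexDeg ≤ deg z.1 + z.2.vertexDeg ∧
      z.2.rootNoise = y.2.rootNoise ∧ (x.2.Valid → y.2.Valid → z.2.Valid) :=
  mem_support_glAct_of_graft mem_support_graft hz

theorem mem_support_monSplit {m u v : Multiset A} (h : (u, v) ∈ (monSplit K m).support) :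
    u + v = m := by
  by_contra H
  refine Finsupp.mem_support_iff.1 h ?_
  rw [← bind_single_one (monSplit K m)]
  have : bind (monSplit K m) (fun p => Finsupp.single p (1 : K)) =
      bind₂ (monSplit K m) fun a b => Finsupp.single (a, b) 1 := by rw [bind₂_eq]
  rw [this, bind₂_monSplit, ← Finsupp.applyAddHom_apply, map_multiset_sum, Multiset.map_map]
  refine Multiset.sum_eq_zero fun c hc => ?_
  obtain ⟨p, hp, rfl⟩ := Multiset.mem_map.1 hc
  refine Finsupp.single_eq_of_ne ?_
  rintro h
  simp only [Prod.mk.injEq] at h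
  exact H (by rw [h.1, h.2]; exact Multiset.mem_antidiagonal.1 hp)

theorem mem_support_monPick {m u : Multiset A} {a : A} (h : (u, a) ∈ (monPick K m).support) :
    a ::ₘ u = m := by
  classical
  by_contra H
  refine Finsupp.mem_support_iff.1 h ?_
  rw [← bind_single_one (monPick K m)]
  have : bind (monPick K m) (fun p => Finsupp.single p (1 : K)) =
      bind₂ (monPick K m) fun a b => Finsupp.single (a, b) 1 := by rw [bind₂_eq]
  rw [this, bind₂_monPick, ← Finsupp.applyAddHom_apply, map_multiset_sum, Multiset.map_map]
  refine Multiset.sum_eq_zero fun c hc => ?_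
  obtain ⟨b, hb, rfl⟩ := Multiset.mem_map.1 hc
  refine Finsupp.single_eq_of_ne ?_
  rintro h
  simp only [Prod.mk.injEq] at h
  exact H (by rw [h.1, h.2]; exact Multiset.cons_erase hb)

end Support

/-! ### Conservation laws for simultaneous insertion -/

section MultiSupport

variable {K : Type*} [Field K] {d : ℕ} {κ ι : Type*}

/-- The labels of all factors of a monomial. -/
def monLabels (m : Multiset (PTree d κ ι)) : Multiset (κ ⊕ ι) := (m.map fun t => t.2.labels).sum

/-- The total size of the edge decorations of all factors of a monomial. -/
def monEdgeDeg (m : Multiset (PTree d κ ι)) : ℕ := (m.map fun t => t.2.edgeDeg).sum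

/-- The total size of the vertex decorations of all factors of a monomial. -/
def monVertexDeg (m : Multiset (PTree d κ ι)) : ℕ := (m.map fun t => deg t.1 + t.2.vertexDeg).sum

/-- All factors of a monomial are valid. -/
def MonValid (m : Multiset (PTree d κ ι)) : Prop := ∀ t ∈ m, t.2.Valid

/-- An inserted tree serves as the base of a grafting and so keeps its edge decorations. Trees
inserted off the root lie above the first edges, hence the bound by `innerEdgeDeg` in `ih`; it
survives a later grafting onto a tree at the root, which deforms only the first edges. -/
theorem mem_support_multi_of_forest {n : Fin d → ℕ} {s : Forest d κ ι}
    (ih : ∀ {m : Multiset (PTree d κ ι)} {u : Forest d κ ι}, u ∈ (multiForest K s m).support →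
      u.labels = s.labels + monLabels m ∧ monEdgeDeg m ≤ u.innerEdgeDeg ∧
      s.vertexDeg ≤ u.vertexDeg ∧
      s.edgeDeg + monEdgeDeg m + u.vertexDeg = u.edgeDeg + s.vertexDeg + monVertexDeg m ∧
      u.rootNoise = s.rootNoise ∧ (s.Valid → MonValid m → u.Valid))
    {m : Multiset (PTree d κ ι)} {z : PTree d κ ι} (hz : z ∈ (multi K (n, s) m).support) :
    z.2.labels = s.labels + monLabels m ∧ monEdgeDeg m ≤ z.2.edgeDeg ∧
      deg n + s.vertexDeg ≤ deg z.1 + z.2.vertexDeg ∧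
      s.edgeDeg + monEdgeDeg m + (deg z.1 + z.2.vertexDeg) =
        z.2.edgeDeg + (deg n + s.vertexDeg) + monVertexDeg m ∧
      (s.Valid → MonValid m → z.2.Valid) := by
  classical
  rw [multi, multiRoot] at hz
  rcases Finset.mem_union.1 (Finsupp.support_add hz) with hz | hz
  · obtain ⟨u, hu, hz⟩ := exists_of_mem_support_bind hz
    cases eq_of_mem_support_single hz
    obtain ⟨h1, h2, h3, h4, -, h5⟩ := ih hu
    have := innerEdgeDeg_le u
    dsimp only
    exact ⟨h1, by omega, by omega, by omega, h5⟩
  · obtain ⟨v, σ, hv, hz⟩ := exists_of_mem_support_bind₂ hz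
    obtain ⟨u, hu, hz⟩ := exists_of_mem_support_bind hz
    obtain ⟨h1, h2, h3, h4, -, h5⟩ := ih hu
    obtain ⟨g1, g2, g3, g4, -, g5⟩ := mem_support_glAct hz
    have hm := mem_support_monPick hv
    subst hm
    simp only [monLabels, monEdgeDeg, monVertexDeg, MonValid, Multiset.map_cons,
      Multiset.sum_cons, Multiset.mem_cons, forall_eq_or_imp] at *
    refine ⟨?_, by omega, by omega, by omega, fun hs hm => g5 (h5 hs hm.2) hm.1⟩
    rw [g1, h1, add_assoc, add_comm (Multiset.sum _)]

theorem mem_support_multiForest {η : Forest d κ ι} {m : Multiset (PTree d κ ι)}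
    {u : Forest d κ ι} (hu : u ∈ (multiForest K η m).support) :
    u.labels = η.labels + monLabels m ∧ monEdgeDeg m ≤ u.innerEdgeDeg ∧
      η.vertexDeg ≤ u.vertexDeg ∧
      η.edgeDeg + monEdgeDeg m + u.vertexDeg = u.edgeDeg + η.vertexDeg + monVertexDeg m ∧
      u.rootNoise = η.rootNoise ∧ (η.Valid → MonValid m → u.Valid) := by
  induction η generalizing m u with
  | nil =>
    rw [multiForest] at hu
    split_ifs at hu with h
    · cases eq_of_mem_support_single hu
      subst h
      simp [monLabels, monEdgeDeg, monVertexDeg, Valid]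
    · simp at hu
  | noise ξ a k r ih =>
    rw [multiForest] at hu
    obtain ⟨v, hv, hu⟩ := exists_of_mem_support_bind hu
    cases eq_of_mem_support_single hu
    obtain ⟨h1, h2, h3, h4, h5, h6⟩ := ih hv
    simp only [labels, edgeDeg, innerEdgeDeg, vertexDeg, rootNoise, Valid]
    refine ⟨by simp [h1], h2, by omega, by omega, by omega, fun hr hm => ?_⟩
    exact ⟨h5.trans hr.1, h6 hr.2 hm⟩
  | kernel i a n s r ihs ihr =>
    rw [multiForest] at hu
    obtain ⟨v, w, hvw, hu⟩ := exists_of_mem_support_bind₂ hu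
    obtain ⟨t, ht, hu⟩ := exists_of_mem_support_bind hu
    obtain ⟨u', hu', hu⟩ := exists_of_mem_support_bind hu
    cases eq_of_mem_support_single hu
    obtain ⟨h1, h2, h3, h4, h5, h6⟩ := ihr hu'
    obtain ⟨g1, g2, g3, g4, g5⟩ := mem_support_multi_of_forest (n := n) ihs ht
    have hm := mem_support_monSplit hvw
    subst hm
    simp only [monLabels, monEdgeDeg, monVertexDeg, MonValid, Multiset.map_add,
      Multiset.sum_add, Multiset.mem_add, labels, edgeDeg, innerEdgeDeg, vertexDeg, rootNoise,
      Valid] at *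
    refine ⟨?_, by omega, by omega, by omega, h5, fun hs hm =>
      ⟨g5 hs.1 fun t ht => hm t (Or.inl ht), h6 hs.2 fun t ht => hm t (Or.inr ht)⟩⟩
    simp only [h1, g1, ← Multiset.singleton_add]; abel

theorem mem_support_multi {t z : PTree d κ ι} {m : Multiset (PTree d κ ι)}
    (hz : z ∈ (multi K t m).support) :
    z.2.labels = t.2.labels + monLabels m ∧ monEdgeDeg m ≤ z.2.edgeDeg ∧
      deg t.1 + t.2.vertexDeg ≤ deg z.1 + z.2.vertexDeg ∧
      t.2.edgeDeg + monEdgeDeg m + (deg z.1 + z.2.vertexDeg) =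
        z.2.edgeDeg + (deg t.1 + t.2.vertexDeg) + monVertexDeg m ∧
      (t.2.Valid → MonValid m → z.2.Valid) :=
  mem_support_multi_of_forest mem_support_multiForest hz

theorem mem_support_multiNonRoot {t z : PTree d κ ι} {m : Multiset (PTree d κ ι)}
    (hz : z ∈ (multiNonRoot K t m).support) :
    (z.2.labels = t.2.labels + monLabels m ∧ monEdgeDeg m ≤ z.2.edgeDeg ∧
      deg t.1 + t.2.vertexDeg ≤ deg z.1 + z.2.vertexDeg ∧
      t.2.edgeDeg + monEdgeDeg m + (deg z.1 + z.2.vertexDeg) =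
        z.2.edgeDeg + (deg t.1 + t.2.vertexDeg) + monVertexDeg m ∧
      (t.2.Valid → MonValid m → z.2.Valid)) ∧ z.2.rootNoise = t.2.rootNoise := by
  rw [multiNonRoot] at hz
  obtain ⟨u, hu, hz⟩ := exists_of_mem_support_bind hz
  cases eq_of_mem_support_single hz
  obtain ⟨h1, h2, h3, h4, h5, h6⟩ := mem_support_multiForest hu
  have := innerEdgeDeg_le u
  dsimp only
  exact ⟨⟨h1, by omega, by omega, by omega, h6⟩, h5⟩

end MultiSupport

/-! ### Finiteness of the renormalisation coactions -/

section Finiteness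

variable {d : ℕ} {κ ι : Type*}

theorem finite_deg_le (c : ℕ) : {a : Fin d → ℕ | deg a ≤ c}.Finite := by
  refine (Set.finite_Iic fun _ => c).subset fun a ha i => ?_
  exact (Finset.single_le_sum (fun _ _ => Nat.zero_le _) (Finset.mem_univ i)).trans ha

theorem finite_forest (L : Multiset (κ ⊕ ι)) (c : ℕ) :
    {f : Forest d κ ι | f.labels ≤ L ∧ f.edgeDeg ≤ c ∧ f.vertexDeg ≤ c}.Finite := by
  -- Induction on the number of edges, the labels being required only to come from L; both
  -- conditions pass to subforests.
  have H : ∀ k : ℕ, {f : Forest d κ ι | f.labels.card ≤ k ∧ (∀ l ∈ f.labels, l ∈ L) ∧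
      f.edgeDeg ≤ c ∧ f.vertexDeg ≤ c}.Finite := by
    intro k
    induction k with
    | zero =>
      refine (Set.finite_singleton nil).subset fun f hf => ?_
      cases f with
      | nil => rfl
      | noise => simp [labels] at hf
      | kernel => simp [labels] at hf
    | succ k ih =>
      set S := {f : Forest d κ ι | f.labels.card ≤ k ∧ (∀ l ∈ f.labels, l ∈ L) ∧
        f.edgeDeg ≤ c ∧ f.vertexDeg ≤ c}
      set D := {a : Fin d → ℕ | deg a ≤ c}
      have hD : D.Finite := finite_deg_le c
      have hL : {l | l ∈ L}.Finite := by
        classical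
        exact (L.toFinset.finite_toSet).subset fun l hl => by simpa using hl
      have hι : {ξ : ι | Sum.inr ξ ∈ L}.Finite := hL.preimage Sum.inr_injective.injOn
      have hκ : {i : κ | Sum.inl i ∈ L}.Finite := hL.preimage Sum.inl_injective.injOn
      have f1 := (hι.prod (hD.prod (hD.prod ih))).image
        fun p : ι × (Fin d → ℕ) × (Fin d → ℕ) × Forest d κ ι => noise p.1 p.2.1 p.2.2.1 p.2.2.2
      have f2 := (hκ.prod (hD.prod (hD.prod (ih.prod ih)))).image
        fun p : κ × (Fin d → ℕ) × (Fin d → ℕ) × Forest d κ ι × Forest d κ ι =>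
          kernel p.1 p.2.1 p.2.2.1 p.2.2.2.1 p.2.2.2.2
      refine ((Set.finite_singleton nil).union (f1.union f2)).subset fun f hf => ?_
      obtain ⟨h1, h2, h3, h4⟩ := hf
      cases f with
      | nil => exact Or.inl rfl
      | noise ξ a k' r =>
        simp only [labels, Multiset.card_cons, Multiset.mem_cons, forall_eq_or_imp, edgeDeg,
          vertexDeg] at h1 h2 h3 h4
        refine Or.inr (Or.inl ⟨(ξ, a, k', r), ⟨h2.1, ?_, ?_, ?_, h2.2, ?_, ?_⟩, rfl⟩)
        · show deg a ≤ c
          omega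
        · show deg k' ≤ c
          omega
        all_goals simp only; omega
      | kernel i a n s r =>
        simp only [labels, Multiset.card_cons, Multiset.mem_cons, forall_eq_or_imp, edgeDeg,
          vertexDeg, Multiset.card_add, Multiset.mem_add] at h1 h2 h3 h4
        refine Or.inr (Or.inr ⟨(i, a, n, s, r), ⟨h2.1, ?_, ?_,
          ⟨?_, fun l hl => h2.2 l (Or.inl hl), ?_, ?_⟩,
          ⟨?_, fun l hl => h2.2 l (Or.inr hl), ?_, ?_⟩⟩, rfl⟩)
        · show deg a ≤ c
          omega
        · show deg n ≤ c
          omega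
        all_goals simp only; omega
  exact (H L.card).subset fun f hf =>
    ⟨Multiset.card_le_card hf.1, fun l hl => Multiset.mem_of_le hf.1 hl, hf.2⟩

theorem finite_tree (L : Multiset (κ ⊕ ι)) (c : ℕ) :
    {t : PTree d κ ι | t.2.labels ≤ L ∧ t.2.edgeDeg ≤ c ∧ deg t.1 + t.2.vertexDeg ≤ c}.Finite :=
  ((finite_deg_le c).prod (finite_forest L c)).subset fun t ht => by
    obtain ⟨h1, h2, h3⟩ := ht
    exact ⟨show deg t.1 ≤ c by omega, h1, h2, by omega⟩

/-- The contribution of an edge to the regularity. -/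
def labelReg (β : κ → ℝ) (α : ι → ℝ) : κ ⊕ ι → ℝ := Sum.elim β fun ξ => α ξ - 1

theorem forest_reg_eq (β : κ → ℝ) (α : ι → ℝ) (f : Forest d κ ι) :
    f.reg β α = (f.labels.map (labelReg β α)).sum - f.edgeDeg + f.vertexDeg := by
  induction f with
  | nil => simp [Forest.reg, labels, edgeDeg, vertexDeg]
  | noise ξ a k r ih => simp [Forest.reg, labels, edgeDeg, vertexDeg, ih, deg, labelReg]; ring
  | kernel i a n s r ihs ihr =>
    simp [Forest.reg, labels, edgeDeg, vertexDeg, ihs, ihr, deg, labelReg]; ring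

/-- Negative regularity means that the vertex decorations amount to less than the edge decorations
minus the label contributions. Absolute values make the bound uniform over all sub-multisets of L.
-/
theorem vertexDeg_le_of_reg_neg (β : κ → ℝ) (α : ι → ℝ) (L : Multiset (κ ⊕ ι)) (c : ℕ) :
    ∃ b : ℕ, ∀ t : PTree d κ ι, reg β α t < 0 → t.2.labels ≤ L → t.2.edgeDeg ≤ c →
      deg t.1 + t.2.vertexDeg ≤ b := by
  obtain ⟨b, hb⟩ := exists_nat_ge ((L.map fun l => |labelReg β α l|).sum + c)
  refine ⟨b, fun t ht hL hc => ?_⟩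
  have h1 : -(t.2.labels.map (labelReg β α)).sum ≤ (L.map fun l => |labelReg β α l|).sum := by
    obtain ⟨M, rfl⟩ := Multiset.le_iff_exists_add.1 hL
    rw [Multiset.map_add, Multiset.sum_add]
    have h2 : (t.2.labels.map fun l => -labelReg β α l).sum ≤
        (t.2.labels.map fun l => |labelReg β α l|).sum :=
      Multiset.sum_map_le_sum_map _ _ fun l _ => neg_le_abs _
    rw [Multiset.sum_map_neg] at h2
    have h3 : 0 ≤ (M.map fun l => |labelReg β α l|).sum := by
      refine Multiset.sum_nonneg fun x hx => ?_
      obtain ⟨l, -, rfl⟩ := Multiset.mem_map.1 hx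
      exact abs_nonneg _
    linarith
  have h2 : reg β α t = (deg t.1 : ℝ) + ((t.2.labels.map (labelReg β α)).sum - t.2.edgeDeg +
      t.2.vertexDeg) := by
    rw [reg, forest_reg_eq]; simp [deg]
  have h3 : (t.2.edgeDeg : ℝ) ≤ c := by exact_mod_cast hc
  have h4 : ((deg t.1 + t.2.vertexDeg : ℕ) : ℝ) ≤ b := by push_cast; linarith
  exact_mod_cast h4

/-- A tree without edges is X^n, of regularity |n| ≥ 0. Hence every negative factor uses up a label,
and the number of factors is bounded. -/
theorem labels_card_pos_of_reg_neg {β : κ → ℝ} {α : ι → ℝ} {t : PTree d κ ι}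
    (ht : reg β α t < 0) : 0 < t.2.labels.card := by
  obtain ⟨n, f⟩ := t
  cases f with
  | nil =>
    simp only [reg, Forest.reg, add_zero] at ht
    exact absurd ht (not_lt.2 (Finset.sum_nonneg fun _ _ => Nat.cast_nonneg _))
  | noise => simp [labels]
  | kernel => simp [labels]

/-- The conditions are the conservation laws satisfied by every term of the coactions of z. They
confine the factors to a finite set of negative trees, the number of factors to at most that of the
edges of z, and the remaining tree to bounded decorations. -/
theorem finite_monomials {β : κ → ℝ} {α : ι → ℝ} (z : PTree d κ ι) :
    {p : NegMon d β α × Tree d κ ι |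
      z.2.labels = p.2.1.2.labels + monLabels (monTrees p.1) ∧
      monEdgeDeg (monTrees p.1) ≤ z.2.edgeDeg ∧
      deg p.2.1.1 + p.2.1.2.vertexDeg ≤ deg z.1 + z.2.vertexDeg ∧
      p.2.1.2.edgeDeg + monEdgeDeg (monTrees p.1) + (deg z.1 + z.2.vertexDeg) =
        z.2.edgeDeg + (deg p.2.1.1 + p.2.1.2.vertexDeg) + monVertexDeg (monTrees p.1)}.Finite := by
  classical
  set L := z.2.labels with hL
  set c := z.2.edgeDeg with hc
  obtain ⟨b, hb⟩ := vertexDeg_le_of_reg_neg (d := d) β α L c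
  have hS : {τ : NegTree d β α | τ.1.2.labels ≤ L ∧ τ.1.2.edgeDeg ≤ c}.Finite := by
    refine Set.Finite.of_finite_image (f := Subtype.val) ((finite_tree L (b + c)).subset ?_)
      Subtype.val_injective.injOn
    rintro _ ⟨τ, ⟨h1, h2⟩, rfl⟩
    exact ⟨h1, by omega, (hb τ.1 τ.2.2 h1 h2).trans (Nat.le_add_right _ _)⟩
  -- The largest conceivable monomial: each admissible factor with exponent `L.card`.
  set M : NegMon d β α := ∑ τ ∈ hS.toFinset, Finsupp.single τ L.card
  -- By the balance of decorations, the edge decorations of t are at most those of z plus the vertex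
  -- decorations of z and of the factors; the latter are at most `L.card * b`.
  have hT : {t : Tree d κ ι | t.1.2.labels ≤ L ∧
      t.1.2.edgeDeg ≤ c + (deg z.1 + z.2.vertexDeg) + L.card * b ∧
      deg t.1.1 + t.1.2.vertexDeg ≤ c + (deg z.1 + z.2.vertexDeg) + L.card * b}.Finite :=
    Set.Finite.of_finite_image (f := Subtype.val) ((finite_tree L _).subset
      (by rintro _ ⟨t, ht, rfl⟩; exact ht)) Subtype.val_injective.injOn
  refine ((Set.finite_Iic M).prod hT).subset ?_
  rintro ⟨a, t⟩ ⟨h1, h2, h3, h4⟩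
  simp only at h1 h2 h3 h4
  have hmem : ∀ σ ∈ monTrees a, reg β α σ < 0 ∧ σ.2.labels ≤ L ∧ σ.2.edgeDeg ≤ c := by
    intro σ hσ
    refine ⟨?_, ?_, ?_⟩
    · obtain ⟨τ, -, rfl⟩ := Multiset.mem_map.1 hσ
      exact τ.2.2
    · rw [h1]
      obtain ⟨m, hm⟩ := Multiset.exists_cons_of_mem hσ
      rw [hm, monLabels, Multiset.map_cons, Multiset.sum_cons, add_left_comm]
      exact Multiset.le_add_right _ _
    · refine le_trans ?_ h2
      exact Multiset.single_le_sum (fun _ _ => Nat.zero_le _) _ (Multiset.mem_map_of_mem _ hσ)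
  have hcard : (monTrees a).card ≤ L.card := by
    rw [h1, Multiset.card_add]
    refine le_trans ?_ (Nat.le_add_left _ _)
    have : ∀ m : Multiset (PTree d κ ι), (∀ σ ∈ m, reg β α σ < 0) →
        m.card ≤ (monLabels m).card := by
      intro m
      induction m using Multiset.induction with
      | empty => simp
      | cons σ m ih =>
        intro h
        have h1 := labels_card_pos_of_reg_neg (h σ (Multiset.mem_cons_self _ _))
        have h2 := ih fun τ hτ => h τ (Multiset.mem_cons_of_mem hτ)
        simp only [monLabels, Multiset.map_cons, Multiset.sum_cons, Multiset.card_cons,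
          Multiset.card_add] at h2 ⊢
        omega
    exact this _ fun σ hσ => (hmem σ hσ).1
  have hvert : monVertexDeg (monTrees a) ≤ L.card * b := by
    refine le_trans (Multiset.sum_le_card_nsmul _ b fun x hx => ?_) ?_
    · obtain ⟨σ, hσ, rfl⟩ := Multiset.mem_map.1 hx
      exact hb σ (hmem σ hσ).1 (hmem σ hσ).2.1 (hmem σ hσ).2.2
    · rw [Multiset.card_map, smul_eq_mul]
      exact Nat.mul_le_mul_right _ hcard
  refine ⟨?_, ?_, ?_, ?_⟩
  · intro τ
    by_cases hτ : a τ = 0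
    · simp [hτ]
    have hτm : τ ∈ Finsupp.toMultiset a := by
      rw [← Multiset.count_pos, Finsupp.count_toMultiset]
      exact Nat.pos_of_ne_zero hτ
    have hτS : τ ∈ hS.toFinset := by
      rw [Set.Finite.mem_toFinset]
      exact (hmem τ.1 (Multiset.mem_map_of_mem _ hτm)).2
    have hM : M τ = L.card := by
      simp only [M, Finsupp.finsetSum_apply, Finsupp.single_apply]
      rw [Finset.sum_ite_eq' _ τ, if_pos hτS]
    rw [hM, ← Finsupp.count_toMultiset]
    refine (Multiset.count_le_card _ _).trans ?_
    rwa [monTrees, Multiset.card_map] at hcard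
  · rw [h1]
    exact Multiset.le_add_right _ _
  · simp only; omega
  · simp only; omega

end Finiteness

/-! ### Factorials and the coproduct of monomials -/

section DividedPowers

variable (K : Type*) [Field K] {J : Type*}

/-- The factorial `a! = ∏ j, (a j)!`. -/
def mfact (a : J →₀ ℕ) : K := a.prod fun _ k => (k.factorial : K)

theorem mfact_add_single (a : J →₀ ℕ) (j : J) :
    mfact K (a + Finsupp.single j 1) = ((a j : K) + 1) * mfact K a := by
  classical
  have key : ∀ b : J →₀ ℕ, b.support ⊆ insert j a.support →
      mfact K b = (b j).factorial * ∏ i ∈ a.support.erase j, ((b i).factorial : K) := by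
    intro b hb
    rw [mfact, Finsupp.prod_of_support_subset _ hb _ (by simp),
      ← Finset.mul_prod_erase _ _ (Finset.mem_insert_self j _), Finset.erase_insert_eq_erase]
  rw [key a (Finset.subset_insert _ _), key (a + Finsupp.single j 1)]
  · have : ∀ i ∈ a.support.erase j, (((a + Finsupp.single j 1 : J →₀ ℕ) i).factorial : K) =
        ((a i).factorial : K) := fun i hi => by
      simp [(Finset.ne_of_mem_erase hi).symm]
    rw [Finset.prod_congr rfl this]
    simp [Nat.factorial_succ, mul_assoc]
  · intro i hi
    by_cases h : i = j
    · simp [h]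
    · simpa [Finsupp.single_apply, h, Ne.symm h] using hi

theorem mfact_ne_zero [CharZero K] (a : J →₀ ℕ) : mfact K a ≠ 0 :=
  Finset.prod_ne_zero_iff.2 fun _ _ => Nat.cast_ne_zero.2 (Nat.factorial_ne_zero _)

variable {K} {A W : Type*} [AddCommGroup W] [Module K W] [DecidableEq J]

/-- The weight kills the terms whose first exponent at j is zero; the others arise by shifting that
exponent. -/
theorem sum_antidiagonal_add_single_fst (a : J →₀ ℕ) (j : J) (H : (J →₀ ℕ) → (J →₀ ℕ) → W) :
    ∑ p ∈ Finset.HasAntidiagonal.antidiagonal (a + Finsupp.single j 1 : J →₀ ℕ), (p.1 j : K) • H p.1 p.2 =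
      ∑ p ∈ Finset.HasAntidiagonal.antidiagonal a, ((p.1 j : K) + 1) • H (p.1 + Finsupp.single j 1) p.2 := by
  symm
  refine Finset.sum_bij_ne_zero (fun p _ _ => (p.1 + Finsupp.single j 1, p.2)) ?_ ?_ ?_ ?_
  · intro p hp _
    rw [Finset.HasAntidiagonal.mem_antidiagonal] at hp ⊢
    rw [← hp, add_right_comm]
  · rintro ⟨b, c⟩ _ _ ⟨b', c'⟩ _ _ h
    simpa using h
  · rintro ⟨b, c⟩ hp hne
    rw [Finset.HasAntidiagonal.mem_antidiagonal] at hp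
    have hb : b j ≠ 0 := fun h => hne (by simp [h])
    have hb' : b - Finsupp.single j 1 + Finsupp.single j 1 = b :=
      tsub_add_cancel_of_le (Finsupp.single_le_iff.2 (Nat.one_le_iff_ne_zero.2 hb))
    refine ⟨(b - Finsupp.single j 1, c), ?_, ?_, by simp only [hb']⟩
    · rw [Finset.HasAntidiagonal.mem_antidiagonal]
      refine add_right_cancel (b := Finsupp.single j 1) ?_
      rw [← hp, add_right_comm, hb']
    · have : (((b - Finsupp.single j 1 : J →₀ ℕ) j : ℕ) : K) + 1 = b j := by
        conv_rhs => rw [← hb']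
        simp
      simp only [hb', this]
      exact hne
  · intro p _ _
    simp

theorem sum_antidiagonal_add_single_snd (a : J →₀ ℕ) (j : J) (H : (J →₀ ℕ) → (J →₀ ℕ) → W) :
    ∑ p ∈ Finset.HasAntidiagonal.antidiagonal (a + Finsupp.single j 1 : J →₀ ℕ), (p.2 j : K) • H p.1 p.2 =
      ∑ p ∈ Finset.HasAntidiagonal.antidiagonal a, ((p.2 j : K) + 1) • H p.1 (p.2 + Finsupp.single j 1) := by
  have swap : ∀ (b : J →₀ ℕ) (G : (J →₀ ℕ) × (J →₀ ℕ) → W),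
      ∑ p ∈ Finset.HasAntidiagonal.antidiagonal b, G p = ∑ p ∈ Finset.HasAntidiagonal.antidiagonal b, G p.swap := by
    intro b G
    conv_lhs => rw [← Finset.HasAntidiagonal.map_swap_antidiagonal, Finset.sum_map]
    rfl
  rw [swap, swap a]
  exact sum_antidiagonal_add_single_fst a j fun b c => H c b

variable [CharZero K]

/-- A splitting into exponents b and c occurs a!/(b! c!) times among the splittings of the multiset.
This multiplicity compensates the square norms in the pairing. -/
theorem bind₂_monSplit_toMultiset (f : J → A) (a : J →₀ ℕ)
    (F : Multiset A → Multiset A → W) :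
    bind₂ (monSplit K ((Finsupp.toMultiset a).map f)) F =
      mfact K a • ∑ p ∈ Finset.HasAntidiagonal.antidiagonal a, ((mfact K p.1)⁻¹ * (mfact K p.2)⁻¹) •
        F ((Finsupp.toMultiset p.1).map f) ((Finsupp.toMultiset p.2).map f) := by
  obtain ⟨s, rfl⟩ : ∃ s, a = Multiset.toFinsupp s := ⟨_, (Finsupp.toMultiset_toFinsupp a).symm⟩
  induction s using Multiset.induction generalizing F with
  | empty => simp [mfact]
  | cons j s ih =>
    have e : Multiset.toFinsupp (j ::ₘ s) = Multiset.toFinsupp s + Finsupp.single j 1 := by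
      rw [← Multiset.singleton_add, map_add, Multiset.toFinsupp_singleton, add_comm]
    have mt : ∀ b : J →₀ ℕ, (Finsupp.toMultiset (b + Finsupp.single j 1)).map f =
        f j ::ₘ (Finsupp.toMultiset b).map f := fun b => by
      rw [map_add, Finsupp.toMultiset_single, one_smul, add_comm, Multiset.singleton_add,
        Multiset.map_cons]
    set a := Multiset.toFinsupp s
    have hj : ∀ b : J →₀ ℕ, ((b j : K) + 1) * (mfact K (b + Finsupp.single j 1))⁻¹ =
        (mfact K b)⁻¹ := fun b => by
      have : (b j : K) + 1 ≠ 0 := Nat.cast_add_one_ne_zero _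
      rw [mfact_add_single, mul_inv, mul_inv_cancel_left₀ this]
    rw [e, mt, bind₂_monSplit_cons, ih, mfact_add_single, mul_comm, mul_smul]
    congr 1
    -- The scalar a_j + 1 is written as b_j + c_j; the two summands correspond to the new factor j
    -- going left or right.
    have h1 : ∀ p ∈ Finset.HasAntidiagonal.antidiagonal (a + Finsupp.single j 1 : J →₀ ℕ),
        ((p.1 j : K) + p.2 j) = a j + 1 := fun p hp => by
      rw [Finset.HasAntidiagonal.mem_antidiagonal] at hp
      have := DFunLike.congr_fun hp j
      simp only [Finsupp.add_apply, Finsupp.single_eq_same] at this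
      exact_mod_cast this
    rw [Finset.smul_sum, Finset.sum_congr rfl fun p hp => (congrArg (· • _) (h1 p hp)).symm]
    simp only [add_smul]
    rw [Finset.sum_add_distrib, sum_antidiagonal_add_single_fst a j fun b c =>
        ((mfact K b)⁻¹ * (mfact K c)⁻¹) •
          F ((Finsupp.toMultiset b).map f) ((Finsupp.toMultiset c).map f),
      sum_antidiagonal_add_single_snd a j fun b c =>
        ((mfact K b)⁻¹ * (mfact K c)⁻¹) •
          F ((Finsupp.toMultiset b).map f) ((Finsupp.toMultiset c).map f)]
    simp only [smul_add, Finset.sum_add_distrib, smul_smul, mt]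
    congr 1
    · refine Finset.sum_congr rfl fun p _ => ?_
      rw [← mul_assoc, hj]
    · refine Finset.sum_congr rfl fun p _ => ?_
      rw [mul_left_comm, hj]

end DividedPowers

/-! ### From sums over valid trees to linear extensions -/

section Coefficients

variable {K : Type*} [Field K] {A A' B B' : Type*}

theorem finsum_mul_eq_bind {g : A' → A} (hg : Function.Injective g) (e : A →₀ K)
    (he : ∀ a ∈ e.support, a ∈ Set.range g) (φ : A → K) :
    ∑ᶠ a' : A', φ (g a') * e (g a') = bind e φ := by
  classical
  rw [finsum_eq_sum_of_support_subset (s := e.support.preimage g hg.injOn),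
    Finset.sum_preimage g _ hg.injOn (fun a => φ a * e a) fun a ha h => absurd (he a ha) h,
    bind_eq_sum, Finsupp.sum]
  · simp only [smul_eq_mul, mul_comm]
  · intro a' ha'
    simp only [Finset.coe_preimage, Set.mem_preimage, Finset.mem_coe, Finsupp.mem_support_iff]
    exact right_ne_zero_of_mul ha'

theorem finsum_mul_mul_eq_bind {g : A' → A} (hg : Function.Injective g) (e : A →₀ K)
    (he : ∀ a ∈ e.support, a ∈ Set.range g) {k : B' → B} (hk : Function.Injective k) (f : B →₀ K)
    (hf : ∀ b ∈ f.support, b ∈ Set.range k) (φ : A → B → K) :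
    ∑ᶠ p : A' × B', φ (g p.1) (k p.2) * (e (g p.1) * f (k p.2)) =
      bind e fun a => bind f fun b => φ a b := by
  rw [finsum_curry]
  · have : ∀ a' : A', ∑ᶠ b' : B', φ (g a') (k b') * (e (g a') * f (k b')) =
        (bind f fun b => φ (g a') b) * e (g a') := by
      intro a'
      rw [← finsum_mul_eq_bind hk f hf, finsum_mul]
      exact finsum_congr fun b' => by ring
    simp only [this]
    exact finsum_mul_eq_bind hg e he fun a => bind f fun b => φ a b
  · refine ((e.support.finite_toSet.preimage hg.injOn).prod
      (f.support.finite_toSet.preimage hk.injOn)).subset fun p hp => ?_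
    have h := right_ne_zero_of_mul hp
    exact ⟨by simpa using left_ne_zero_of_mul h, by simpa using right_ne_zero_of_mul h⟩

end Coefficients

/-! ### Dualisation -/

section Coactions

variable {K : Type*} [Field K] {d : ℕ} {κ ι : Type*} {β : κ → ℝ} {α : ι → ℝ}

theorem monValid_monTrees (a : NegMon d β α) : MonValid (monTrees a) := by
  intro t ht
  obtain ⟨τ, -, rfl⟩ := Multiset.mem_map.1 ht
  exact τ.2.1

theorem deltaPlusZero_apply (z : Tree d κ ι) (p : Tree d κ ι × Tree d κ ι) :
    deltaPlusZero K z p = glAct K p.1.1 p.2.1 z.1 := by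
  rw [deltaPlusZero]
  split_ifs with h
  · rfl
  · rw [glAct_eq_zero h, Finsupp.zero_apply]

theorem deltaMinus_apply (z : Tree d κ ι) (p : NegMon d β α × Tree d κ ι) :
    deltaMinus K β α z p = (mfact K p.1)⁻¹ * multi K p.2.1 (monTrees p.1) z.1 := by
  rw [deltaMinus, dualCoaction, actMon_insertion, mfact]

theorem deltaMinusNonRoot_apply (z : Tree d κ ι) (p : NegMon d β α × Tree d κ ι) :
    deltaMinusNonRoot K β α z p = (mfact K p.1)⁻¹ * multiNonRoot K p.2.1 (monTrees p.1) z.1 := by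
  rw [deltaMinusNonRoot, dualCoaction, actMon_insertionNonRoot, mfact]

theorem finite_support_deltaMinus (z : Tree d κ ι) :
    (Function.support (deltaMinus K β α z)).Finite := by
  refine (finite_monomials z.1).subset fun p hp => ?_
  rw [Function.mem_support, deltaMinus_apply] at hp
  obtain ⟨h1, h2, h3, h4, -⟩ :=
    mem_support_multi (Finsupp.mem_support_iff.2 (right_ne_zero_of_mul hp))
  exact ⟨h1, h2, h3, h4⟩

theorem finite_support_deltaMinusNonRoot (z : Tree d κ ι) :
    (Function.support (deltaMinusNonRoot K β α z)).Finite := by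
  refine (finite_monomials z.1).subset fun p hp => ?_
  rw [Function.mem_support, deltaMinusNonRoot_apply] at hp
  obtain ⟨⟨h1, h2, h3, h4, -⟩, -⟩ :=
    mem_support_multiNonRoot (Finsupp.mem_support_iff.2 (right_ne_zero_of_mul hp))
  exact ⟨h1, h2, h3, h4⟩

theorem extends_idMap_deltaPlusZero :
    Extends K (idMap K (NegMon d β α)) (deltaPlusZero K (d := d) (κ := κ) (ι := ι)) := by
  intro b e
  refine ((Set.finite_singleton b).prod ((glAct K e.1.1 e.2.1).support.finite_toSet.preimage
    Subtype.val_injective.injOn)).subset fun p hp => ⟨?_, ?_⟩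
  · have := left_ne_zero_of_mul hp
    simp only [idMap, ne_eq, ite_eq_right_iff, one_ne_zero, imp_false, not_not] at this
    exact this
  · have := right_ne_zero_of_mul hp
    rw [deltaPlusZero_apply] at this
    simpa using this

/-- For fixed output basis elements the coefficients are, up to scalars, those of fixed action
values, and these have finite support. -/
theorem extends_deltaMinusNonRoot_deltaMinus :
    Extends K (deltaMinusNonRoot K (d := d) β α) (deltaMinus K (d := d) β α) := by
  intro b e
  refine (((multiNonRoot K b.2.1 (monTrees b.1)).support.finite_toSet.preimage
    Subtype.val_injective.injOn).prod ((multi K e.2.1 (monTrees e.1)).support.finite_toSet.preimage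
    Subtype.val_injective.injOn)).subset fun p hp => ⟨?_, ?_⟩
  · have := left_ne_zero_of_mul hp
    rw [deltaMinusNonRoot_apply] at this
    simpa using right_ne_zero_of_mul this
  · have := right_ne_zero_of_mul hp
    rw [deltaMinus_apply] at this
    simpa using right_ne_zero_of_mul this

/-- The pairing with a fixed linear combination of trees. -/
def pairing (w : Tree d κ ι →₀ K) : (PTree d κ ι →₀ K) →ₗ[K] K :=
  ∑ z ∈ w.support, w z • Finsupp.lapply z.1

theorem pairing_apply (w : Tree d κ ι →₀ K) (e : PTree d κ ι →₀ K) :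
    pairing w e = ∑ z ∈ w.support, w z * e z.1 := by
  simp [pairing]

theorem lin_deltaMinus_apply (w : Tree d κ ι →₀ K) (p : NegMon d β α × Tree d κ ι) :
    lin K (deltaMinus K β α) w p = (mfact K p.1)⁻¹ * pairing w (multi K p.2.1 (monTrees p.1)) := by
  simp only [lin, Finsupp.linearCombination_apply, Finsupp.sum, Finset.sum_apply, Pi.smul_apply,
    smul_eq_mul, deltaMinus_apply, pairing_apply, Finset.mul_sum, mul_left_comm]

theorem lin_deltaPlusZero_apply (w : Tree d κ ι →₀ K) (p : Tree d κ ι × Tree d κ ι) :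
    lin K (deltaPlusZero K) w p = pairing w (glAct K p.1.1 p.2.1) := by
  simp only [lin, Finsupp.linearCombination_apply, Finsupp.sum, Finset.sum_apply, Pi.smul_apply,
    smul_eq_mul, deltaPlusZero_apply, pairing_apply]

theorem cointeraction [CharZero K] (w : Tree d κ ι →₀ K) :
    tensorMap K (idMap K (NegMon d β α)) (deltaPlusZero K) (lin K (deltaMinus K β α) w) =
      mul13 K (tensorMap K (deltaMinusNonRoot K β α) (deltaMinus K β α)
        (lin K (deltaPlusZero K) w)) := by
  classical
  funext ⟨a, x, y⟩
  -- The actions preserve validity, so sums over valid trees run over the full supports.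
  have hrange : ∀ t : PTree d κ ι, t.2.Valid →
      t ∈ Set.range (Subtype.val : Tree d κ ι → PTree d κ ι) := fun t ht => ⟨⟨t, ht⟩, rfl⟩
  have lhs : tensorMap K (idMap K (NegMon d β α)) (deltaPlusZero K)
      (lin K (deltaMinus K β α) w) (a, x, y) =
      (mfact K a)⁻¹ * pairing w (bind (glAct K x.1 y.1) fun t => multi K t (monTrees a)) := by
    have h1 : (fun p : NegMon d β α × Tree d κ ι =>
        lin K (deltaMinus K β α) w p * (idMap K (NegMon d β α) p.1 a * deltaPlusZero K p.2 (x, y))) =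
        fun p => (mfact K p.1)⁻¹ * pairing w (multi K p.2.1 (monTrees p.1)) *
          (Finsupp.single a (1 : K) p.1 * glAct K x.1 y.1 p.2.1) := by
      funext p
      rw [lin_deltaMinus_apply, deltaPlusZero_apply, idMap, Finsupp.single_apply]
      simp only [eq_comm]
    rw [tensorMap]
    simp only [h1]
    have := finsum_mul_mul_eq_bind (K := K) (g := id) Function.injective_id
      (Finsupp.single a 1) (fun a _ => ⟨a, rfl⟩) (k := (Subtype.val : Tree d κ ι → PTree d κ ι))
      Subtype.val_injective (glAct K x.1 y.1)
      (fun t ht => hrange t ((mem_support_glAct ht).2.2.2.2.2 x.2 y.2))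
      fun b t => (mfact K b)⁻¹ * pairing w (multi K t (monTrees b))
    refine this.trans ?_
    rw [bind_pure, map_bind]
    exact bind_fun_smul _ _ _
  have rhs : ∀ b c : NegMon d β α, tensorMap K (deltaMinusNonRoot K β α) (deltaMinus K β α)
        (lin K (deltaPlusZero K) w) ((b, x), (c, y)) =
      ((mfact K b)⁻¹ * (mfact K c)⁻¹) * pairing w (bind (multiNonRoot K x.1 (monTrees b)) fun x' =>
        bind (multi K y.1 (monTrees c)) fun y' => glAct K x' y') := by
    intro b c
    have h1 : (fun p : Tree d κ ι × Tree d κ ι =>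
        lin K (deltaPlusZero K) w p *
          (deltaMinusNonRoot K β α p.1 (b, x) * deltaMinus K β α p.2 (c, y))) =
        fun p => ((mfact K b)⁻¹ * (mfact K c)⁻¹) * pairing w (glAct K p.1.1 p.2.1) *
          (multiNonRoot K x.1 (monTrees b) p.1.1 * multi K y.1 (monTrees c) p.2.1) := by
      funext p
      rw [lin_deltaPlusZero_apply, deltaMinus_apply, deltaMinusNonRoot_apply]
      ring
    rw [tensorMap]
    simp only [h1]
    refine (finsum_mul_mul_eq_bind (K := K) Subtype.val_injective
      (multiNonRoot K x.1 (monTrees b))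
      (fun t ht => hrange t ((mem_support_multiNonRoot ht).1.2.2.2.2 x.2 (monValid_monTrees b)))
      Subtype.val_injective (multi K y.1 (monTrees c))
      (fun t ht => hrange t ((mem_support_multi ht).2.2.2.2 y.2 (monValid_monTrees c)))
      fun u v => ((mfact K b)⁻¹ * (mfact K c)⁻¹) * pairing w (glAct K u v)).trans ?_
    simp only [map_bind, ← smul_eq_mul, bind_fun_smul]
  rw [lhs, mul13]
  simp only [rhs]
  have key := bind_glAct_multi (K := K) x.1 y.1 (monTrees a) fun u => Finsupp.single u (1 : K)
  simp only [bind_single_one] at key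
  -- The factor a! from the splitting cancels the inverse square norm of a, leaving the inverse
  -- norms of the two parts. This is where characteristic zero enters.
  rw [key, monTrees, bind₂_monSplit_toMultiset, map_smul, map_sum, smul_eq_mul,
    inv_mul_cancel_left₀ (mfact_ne_zero K a)]
  simp only [map_smul, smul_eq_mul, monTrees]
  congr!

end Coactions

end PlanarRS

end

/-! ### The theorem -/

theorem mainTheorem3 {K : Type*} [Field K] [CharZero K] {d : ℕ} {κ ι : Type*}
    (β : κ → ℝ) (α : ι → ℝ) :
    -- the actions of products of negative trees do not depend on the order of the factors
    (∀ (n : ℕ) (τ : Fin n → PlanarRS.NegTree d β α) (π : Equiv.Perm (Fin n))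
        (t : PlanarRS.Tree d κ ι),
      PlanarRS.act K (PlanarRS.insertion K) n (fun i => (τ (π i)).1) t.1 =
          PlanarRS.act K (PlanarRS.insertion K) n (fun i => (τ i).1) t.1 ∧
      PlanarRS.act K (PlanarRS.insertionNonRoot K) n (fun i => (τ (π i)).1) t.1 =
          PlanarRS.act K (PlanarRS.insertionNonRoot K) n (fun i => (τ i).1) t.1) ∧
    -- the renormalisation coactions take values in the algebraic tensor product
    (∀ z : PlanarRS.Tree d κ ι,
      (Function.support (PlanarRS.deltaMinus K β α z)).Finite ∧
      (Function.support (PlanarRS.deltaMinusNonRoot K β α z)).Finite) ∧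
    -- the tensor products of maps below are well defined on completed tensor products
    PlanarRS.Extends K (PlanarRS.idMap K (PlanarRS.NegMon d β α))
      (PlanarRS.deltaPlusZero K (d := d) (κ := κ) (ι := ι)) ∧
    PlanarRS.Extends K (PlanarRS.deltaMinusNonRoot K (d := d) β α)
      (PlanarRS.deltaMinus K (d := d) β α) ∧
    -- cointeraction
    ∀ w : PlanarRS.Tree d κ ι →₀ K,
      PlanarRS.tensorMap K (PlanarRS.idMap K (PlanarRS.NegMon d β α)) (PlanarRS.deltaPlusZero K)
          (PlanarRS.lin K (PlanarRS.deltaMinus K β α) w) =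
        PlanarRS.mul13 K
          (PlanarRS.tensorMap K (PlanarRS.deltaMinusNonRoot K β α) (PlanarRS.deltaMinus K β α)
            (PlanarRS.lin K (PlanarRS.deltaPlusZero K) w)) := 
  ⟨fun n τ π t => ⟨by
      rw [PlanarRS.act_insertion, PlanarRS.act_insertion,
        PlanarRS.monOf_comp_perm (fun i => (τ i).1) π], by
      rw [PlanarRS.act_insertionNonRoot, PlanarRS.act_insertionNonRoot,
        PlanarRS.monOf_comp_perm (fun i => (τ i).1) π]⟩,
    fun z => ⟨PlanarRS.finite_support_deltaMinus z, PlanarRS.finite_support_deltaMinusNonRoot z⟩,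
    PlanarRS.extends_idMap_deltaPlusZero, PlanarRS.extends_deltaMinusNonRoot_deltaMinus,
    PlanarRS.cointeraction⟩
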